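/- The common term (CT) problem is undecidable for dwindling convergent string-rewriting systems. Precisely: a finite string-rewriting system $S$ over a finite alphabet $\Sigma$ is a finite set of rules $l \to r$ with $l, r \in \Sigma^*$; it induces the one-step reduction $xly \to_S xry$ for $(l \to r) \in S$ and $x, y \in \Sigma^*$. Write $\to_S^*$ for the reflexive transitive closure of $\to_S$ and $\leftrightarrow_S^*$ for its reflexive symmetric transitive closure. $S$ is *convergent* if it is terminating (there is no infinite chain $t_0 \to_S t_1 \to_S \cdots$) and confluent (whenever $t \to_S^* s_1$ and $t \to_S^* s_2$, there is $t'$ with $s_1 \to_S^* t'$ and $s_2 \to_S^* t'$). $S$ is *dwindling* if for every rule $l \to r$ of $S$ the string $r$ is a proper prefix of $l$. **Theorem.** There is no algorithm which, given a finite non-empty alphabet $\Sigma$, a finite dwindling convergent string-rewriting system $S$ over $\Sigma$ and strings $\alpha, \beta \in \Sigma^*$, always halts and decides whether there is a string $W \in \Sigma^*$ with $\alpha W \leftrightarrow_S^* \beta W$. (Nothing is required of the algorithm on inputs that are not of this form.) -/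

import Mathlib

namespace StringRewriting

/-- A rewrite rule `l → r` over the alphabet `A`, as the pair `(l, r)` of strings. -/
abbrev Rule (A : Type*) := List A × List A

/-- A finite string-rewriting system over the alphabet `A`: a finite list of rules. -/
abbrev FiniteSRS (A : Type*) := List (Rule A)

/-- The single-step reduction `x l y → x r y` for a rule `l → r` of `S` and strings `x`, `y`. -/
def Step {A : Type*} (S : FiniteSRS A) (u v : List A) : Prop :=
  ∃ l r x y : List A, (l, r) ∈ S ∧ u = x ++ l ++ y ∧ v = x ++ r ++ y

/-- The reflexive and transitive closure of the single-step reduction. -/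
def Reduces {A : Type*} (S : FiniteSRS A) : List A → List A → Prop :=
  Relation.ReflTransGen (Step S)

/-- The reflexive, symmetric and transitive closure of the single-step reduction. -/
def Equivalent {A : Type*} (S : FiniteSRS A) : List A → List A → Prop :=
  Relation.EqvGen (Step S)

/-- There is no infinite reduction chain. -/
def Terminating {A : Type*} (S : FiniteSRS A) : Prop :=
  ¬ ∃ t : ℕ → List A, ∀ n, Step S (t n) (t (n + 1))

/-- Any two strings derived from a common string can be reduced to a common string. -/
def Confluent {A : Type*} (S : FiniteSRS A) : Prop :=
  ∀ t s₁ s₂ : List A, Reduces S t s₁ → Reduces S t s₂ →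
    ∃ t' : List A, Reduces S s₁ t' ∧ Reduces S s₂ t'

/-- Terminating and confluent. -/
def Convergent {A : Type*} (S : FiniteSRS A) : Prop :=
  Terminating S ∧ Confluent S

/-- The right-hand side of every rule is a proper prefix of its left-hand side. -/
def Dwindling {A : Type*} (S : FiniteSRS A) : Prop :=
  ∀ l r : List A, (l, r) ∈ S → r <+: l ∧ r ≠ l

/-- The question of the common term problem: is there `W` with `αW ↔* βW`? -/
def HasCommonTerm {A : Type*} (S : FiniteSRS A) (α β : List A) : Prop :=
  ∃ W : List A, Equivalent S (α ++ W) (β ++ W)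

/-- A string over the alphabet `Fin k` as a sequence of natural numbers. -/
def encodeString {k : ℕ} (w : List (Fin k)) : List ℕ :=
  w.map fun a => (a : ℕ)

/-- The input to an algorithm for the common term problem: the size of the alphabet, the list of
rules, and the two strings, with the letters written as natural numbers. -/
abbrev CTInput := ℕ × List (List ℕ × List ℕ) × List ℕ × List ℕ

/-- The instance of the common term problem given by the alphabet `Fin k`, the system `S`, and the
strings `α`, `β`, written as an input for an algorithm. -/
def encodeInstance {k : ℕ} (S : FiniteSRS (Fin k)) (α β : List (Fin k)) : CTInput :=
  (k, S.map fun p => (encodeString p.1, encodeString p.2), encodeString α, encodeString β)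

end StringRewriting

/-! A dwindling rule can only erase. Suppose that every rule ends in a trigger letter from `Op` that
rules contain nowhere else, and that at most one rule applies at a time. Then a normal form is a
stack: a data letter fed to it is pushed, a trigger either fires and erases part of the top, or gets
stuck. A stuck trigger shields all that lies below it for ever. So a common term of two trigger-free
strings amounts to a sequence of letters that drives two stacks in lockstep to equality
(`hasCommonTerm_iff`): a trigger stuck on one side only can never be made good (`feedAll_ne`), and
one stuck on both sides forces the strings to be equal already.

Two such stacks simulate a two-stack machine, although each letter goes to both. One string holds
the left stack and the state, the other the right stack. Letters meant for the right stack are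
pushed on both and then erased on the left by `prep i`; letters meant for the left stack are pushed
on both and then erased on the right by `exec i`. Conversely, the invariant `Tracks` says that above
the current stacks there is only a common word `D`. A rule that reaches below `D` must do so on both
sides, and the state on the left or the mark on the right then leaves only the intended rules. These
letters also keep the two strings distinct, so a common term exists only if the final state is
reached.

Finally the two-stack machine runs a Turing machine whose halting problem is undecidable on inputs
with a single block of varying length, so the instances are computable from that length. -/

namespace StringRewriting

/-! ### Systems with trigger letters, and their normal forms as stacks -/

section OpTerminated

variable {A : Type*}

/-- Every rule is triggered by a letter from `Op` that ends its left-hand side and occurs nowhere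
else in the rules, the right-hand side is a prefix of what precedes that letter, and at most one
rule applies at a time. -/
structure OpTerminated (S : FiniteSRS A) (Op : Set A) : Prop where
  shape : ∀ l r, (l, r) ∈ S → ∃ w o, l = w ++ [o] ∧ o ∈ Op ∧ (∀ a ∈ w, a ∉ Op) ∧ r <+: w
  unique : ∀ w w' r r' o, (w ++ [o], r) ∈ S → (w' ++ [o], r') ∈ S → w <:+ w' → w = w' ∧ r = r'

/-- The letter `o` turns the normal form `u` into `v` by an application of a rule. -/
def Fires (S : FiniteSRS A) (o : A) (u v : List A) : Prop :=
  ∃ p w r, (w ++ [o], r) ∈ S ∧ u = p ++ w ∧ v = p ++ r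

open Classical in
/-- The normal form of `u ++ [a]` for a normal form `u`. -/
noncomputable def feed (S : FiniteSRS A) (u : List A) (a : A) : List A :=
  if h : ∃ v, Fires S a u v then h.choose else u ++ [a]

/-- The normal form of `u ++ W` for a normal form `u`. -/
noncomputable def feedAll (S : FiniteSRS A) (u W : List A) : List A :=
  W.foldl (feed S) u

variable {S : FiniteSRS A} {Op : Set A}

@[simp] theorem feedAll_nil (u : List A) : feedAll S u [] = u := rfl

@[simp] theorem feedAll_cons (u : List A) (a : A) (W : List A) :
    feedAll S u (a :: W) = feedAll S (feed S u a) W := rfl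

theorem feedAll_append (u V W : List A) :
    feedAll S u (V ++ W) = feedAll S (feedAll S u V) W := by
  simp [feedAll]

namespace OpTerminated

theorem shape' (h : OpTerminated S Op) {w r : List A} {o : A} (hm : (w ++ [o], r) ∈ S) :
    o ∈ Op ∧ (∀ a ∈ w, a ∉ Op) ∧ r <+: w := by
  obtain ⟨w', o', e, h1, h2, h3⟩ := h.shape _ _ hm
  obtain ⟨rfl, e⟩ := List.append_inj' e rfl
  obtain rfl : o = o' := by simpa using e
  exact ⟨h1, h2, h3⟩

theorem fires_unique (h : OpTerminated S Op) {o : A} {u v v' : List A} (h1 : Fires S o u v)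
    (h2 : Fires S o u v') : v = v' := by
  obtain ⟨p, w, r, hm, rfl, rfl⟩ := h1
  obtain ⟨p', w', r', hm', e, rfl⟩ := h2
  have key : w = w' ∧ r = r' := by
    rcases List.suffix_or_suffix_of_suffix (List.suffix_append p w)
      (e ▸ List.suffix_append p' w') with hs | hs
    · exact h.unique _ _ _ _ _ hm hm' hs
    · obtain ⟨e1, e2⟩ := h.unique _ _ _ _ _ hm' hm hs
      exact ⟨e1.symm, e2.symm⟩
  obtain ⟨rfl, rfl⟩ := key
  rw [List.append_cancel_right e]

theorem feed_of_fires (h : OpTerminated S Op) {o : A} {u v : List A} (h1 : Fires S o u v) :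
    feed S u o = v := by
  have hex : ∃ v, Fires S o u v := ⟨v, h1⟩
  rw [feed, dif_pos hex]
  exact h.fires_unique hex.choose_spec h1

theorem feed_of_not_fires {o : A} {u : List A} (h1 : ¬ ∃ v, Fires S o u v) :
    feed S u o = u ++ [o] := by
  rw [feed, dif_neg h1]

theorem not_fires (h : OpTerminated S Op) {a : A} (ha : a ∉ Op) (u : List A) :
    ¬ ∃ v, Fires S a u v := by
  rintro ⟨v, p, w, r, hm, -⟩
  exact ha (h.shape' hm).1

theorem feed_data (h : OpTerminated S Op) {a : A} (ha : a ∉ Op) (u : List A) :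
    feed S u a = u ++ [a] :=
  feed_of_not_fires (h.not_fires ha u)

theorem feedAll_data (h : OpTerminated S Op) (W : List A) (hW : ∀ a ∈ W, a ∉ Op) (u : List A) :
    feedAll S u W = u ++ W := by
  induction W generalizing u with
  | nil => simp
  | cons a W ih =>
    rw [feedAll_cons, h.feed_data (hW a (by simp)), ih (fun b hb => hW b (by simp [hb]))]
    simp

theorem dwindling (h : OpTerminated S Op) : Dwindling S := by
  intro l r hm
  obtain ⟨w, o, rfl, -, -, hp⟩ := h.shape _ _ hm
  refine ⟨hp.trans (List.prefix_append _ _), fun e => ?_⟩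
  have := hp.length_le
  simp [e] at this

theorem terminating (h : OpTerminated S Op) : Terminating S := by
  rintro ⟨t, ht⟩
  have hlt : ∀ n, (t (n + 1)).length < (t n).length := by
    intro n
    obtain ⟨l, r, x, y, hm, e1, e2⟩ := ht n
    obtain ⟨hp, hne⟩ := h.dwindling l r hm
    have : r.length < l.length :=
      lt_of_le_of_ne hp.length_le fun e => hne (hp.eq_of_length e)
    rw [e1, e2]
    simp [this]
  have hle : ∀ n, (t n).length + n ≤ (t 0).length := by
    intro n
    induction n with
    | zero => simp
    | succ n ih => have := hlt n; omega
  have := hle ((t 0).length + 1)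
  omega

/-- The part of the left-hand side before its trigger consists of data, so it is pushed unchanged on
whatever lies below, and then the rule fires. This invariance of the computed normal form yields
confluence. -/
theorem feedAll_step (h : OpTerminated S Op) {u v : List A} (hs : Step S u v) :
    feedAll S [] u = feedAll S [] v := by
  obtain ⟨l, r, x, y, hm, rfl, rfl⟩ := hs
  obtain ⟨w, o, rfl, ho, hw, hp⟩ := h.shape _ _ hm
  simp only [feedAll_append, feedAll_cons, feedAll_nil]
  rw [h.feedAll_data w hw, h.feedAll_data r fun a ha => hw a (hp.subset ha)]
  rw [h.feed_of_fires ⟨_, w, r, hm, rfl, rfl⟩]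

theorem feedAll_equivalent (h : OpTerminated S Op) {u v : List A} (hs : Equivalent S u v) :
    feedAll S [] u = feedAll S [] v := by
  induction hs with
  | rel _ _ hs => exact h.feedAll_step hs
  | refl => rfl
  | symm _ _ _ ih => exact ih.symm
  | trans _ _ _ _ _ ih1 ih2 => exact ih1.trans ih2

end OpTerminated

theorem Step.append_right {u v : List A} (h : Step S u v) (z : List A) :
    Step S (u ++ z) (v ++ z) := by
  obtain ⟨l, r, x, y, hm, rfl, rfl⟩ := h
  exact ⟨l, r, x, y ++ z, hm, by simp, by simp⟩

theorem Reduces.append_right {u v : List A} (h : Reduces S u v) (z : List A) :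
    Reduces S (u ++ z) (v ++ z) := by
  induction h with
  | refl => exact .refl
  | tail _ hs ih => exact ih.tail (Step.append_right hs z)

theorem Reduces.equivalent {u v : List A} (h : Reduces S u v) : Equivalent S u v :=
  Relation.EqvGen.is_equivalence _ |>.eqvGen_iff.1 (by
    induction h with
    | refl => exact .refl _
    | tail _ hs ih => exact .trans _ _ _ ih (.rel _ _ (.rel _ _ hs)))

theorem reduces_feed (u : List A) (a : A) : Reduces S (u ++ [a]) (feed S u a) := by
  by_cases hex : ∃ v, Fires S a u v
  · rw [feed, dif_pos hex]
    obtain ⟨p, w, r, hm, e1, e2⟩ := hex.choose_spec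
    rw [e2]
    nth_rw 1 [e1]
    exact .single ⟨w ++ [a], r, p, [], hm, by simp, by simp⟩
  · rw [feed, dif_neg hex]
    exact .refl

theorem reduces_feedAll (W u : List A) : Reduces S (u ++ W) (feedAll S u W) := by
  induction W generalizing u with
  | nil => rw [List.append_nil]; exact .refl
  | cons a W ih =>
    have h1 := (reduces_feed (S := S) u a).append_right W
    simp only [List.append_assoc, List.cons_append, List.nil_append] at h1
    exact h1.trans (ih _)

/-- Feeding the same letter to two normal forms: either the letter starts no rule and is pushed
on both, or it fires a rule on both. -/
inductive JointStep (S : FiniteSRS A) (Op : Set A) : List A × List A → List A × List A → Prop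
  | push (a : A) (u v : List A) : a ∉ Op → JointStep S Op (u, v) (u ++ [a], v ++ [a])
  | fire (o : A) (u v u' v' : List A) : o ∈ Op → Fires S o u u' → Fires S o v v' →
      JointStep S Op (u, v) (u', v')

/-! ### Convergence, and common terms as joint computations of two stacks -/

namespace OpTerminated

theorem confluent (h : OpTerminated S Op) : Confluent S := by
  intro t s₁ s₂ h1 h2
  refine ⟨feedAll S [] t, ?_, ?_⟩
  · rw [h.feedAll_equivalent h1.equivalent]; exact reduces_feedAll s₁ []
  · rw [h.feedAll_equivalent h2.equivalent]; exact reduces_feedAll s₂ []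

theorem convergent (h : OpTerminated S Op) : Convergent S := ⟨h.terminating, h.confluent⟩

theorem equivalent_iff (h : OpTerminated S Op) (u v : List A) :
    Equivalent S u v ↔ feedAll S [] u = feedAll S [] v := by
  refine ⟨h.feedAll_equivalent, fun e => ?_⟩
  have h1 := (reduces_feedAll (S := S) u []).equivalent
  have h2 := (reduces_feedAll (S := S) v []).equivalent
  rw [List.nil_append] at h1 h2
  rw [← e] at h2
  exact .trans _ _ _ h1 (.symm _ _ h2)

/-- A left-hand side has no trigger except at its end, so no match can extend across the stuck `o`.
-/
theorem feedAll_op_append (h : OpTerminated S Op) {o : A} (ho : o ∈ Op) (P s W : List A) :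
    feedAll S (P ++ [o] ++ s) W = P ++ [o] ++ feedAll S s W := by
  induction W generalizing s with
  | nil => simp
  | cons a W ih =>
    rw [feedAll_cons, feedAll_cons]
    by_cases hex : ∃ v, Fires S a s v
    · obtain ⟨v, hv⟩ := hex
      rw [h.feed_of_fires hv]
      obtain ⟨p, w, r, hm, rfl, rfl⟩ := hv
      rw [h.feed_of_fires (v := P ++ [o] ++ (p ++ r)) ⟨P ++ [o] ++ p, w, r, hm, by simp, by simp⟩,
        ih]
    · rw [feed_of_not_fires hex, feed_of_not_fires, List.append_assoc (P ++ [o]), ih]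
      rintro ⟨v, p, w, r, hm, e, rfl⟩
      rcases List.suffix_or_suffix_of_suffix (List.suffix_append (P ++ [o]) s)
        (e ▸ List.suffix_append p w) with hs | ⟨p', rfl⟩
      · obtain ⟨p', rfl⟩ := hs
        rcases List.eq_nil_or_concat p' with rfl | ⟨p', b, rfl⟩
        · exact hex ⟨[] ++ r, [], s, r, hm, rfl, rfl⟩
        · have e' : P ++ [o] = (p ++ p') ++ [b] := by
            apply List.append_cancel_right (bs := s)
            simpa using e
          obtain ⟨-, e'⟩ := List.append_inj' e' rfl
          obtain rfl : o = b := by simpa using e'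
          exact (h.shape' hm).2.1 o (by simp) ho
      · exact hex ⟨p' ++ r, p', w, r, hm, rfl, rfl⟩

open Classical in
theorem countP_fires (h : OpTerminated S Op) {o : A} {u v : List A} (hf : Fires S o u v) :
    v.countP (· ∈ Op) ≤ u.countP (· ∈ Op) := by
  obtain ⟨p, w, r, hm, rfl, rfl⟩ := hf
  exact ((List.prefix_append_right_inj p).2 (h.shape' hm).2.2).sublist.countP_le

open Classical in
/-- More letters below can only make more rules fire. -/
theorem countP_feedAll_le (h : OpTerminated S Op) (W G T s : List A)
    (hG : G = [] ∨ ∃ P, ∃ o ∈ Op, G = P ++ [o]) (hGT : T.countP (· ∈ Op) ≤ G.countP (· ∈ Op)) :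
    (feedAll S (T ++ s) W).countP (· ∈ Op) ≤ G.countP (· ∈ Op) +
      (feedAll S s W).countP (· ∈ Op) := by
  induction W generalizing G T s with
  | nil => simpa using hGT
  | cons a W ih =>
    rw [feedAll_cons, feedAll_cons]
    by_cases hex : ∃ v, Fires S a s v
    · obtain ⟨v, hv⟩ := hex
      rw [h.feed_of_fires hv]
      obtain ⟨p, w, r, hm, rfl, rfl⟩ := hv
      rw [h.feed_of_fires (v := T ++ (p ++ r)) ⟨T ++ p, w, r, hm, by simp, by simp⟩]
      exact ih _ _ _ hG hGT
    · rw [feed_of_not_fires hex]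
      by_cases ha : a ∈ Op
      · have e : feedAll S (s ++ [a]) W = s ++ [a] ++ feedAll S [] W := by
          simpa using h.feedAll_op_append ha s [] W
        -- The stuck trigger freezes `G ++ s ++ [a]`, which has at least as many triggers as what `T
        -- ++ s` becomes, whether or not `a` fires there. It replaces `G`, and the part above it is
        -- now empty.
        have key : (feedAll S (feed S (T ++ s) a ++ []) W).countP (· ∈ Op) ≤
            (G ++ s ++ [a]).countP (· ∈ Op) + (feedAll S [] W).countP (· ∈ Op) := by
          refine ih _ _ _ (.inr ⟨_, a, ha, rfl⟩) ?_
          by_cases hex' : ∃ v, Fires S a (T ++ s) v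
          · obtain ⟨v, hv⟩ := hex'
            rw [h.feed_of_fires hv]
            have := h.countP_fires hv
            simp only [List.countP_append] at this ⊢
            omega
          · rw [feed_of_not_fires hex']
            simp only [List.countP_append]
            omega
        rw [e]
        simp only [List.append_nil, List.countP_append] at key ⊢
        omega
      · rw [h.feed_data ha, List.append_assoc]
        exact ih _ _ _ hG hGT

open Classical in
-- Count the triggers. Above the stuck `o`, `W` acts as on the empty stack, so the left side has at
-- least one trigger more than `feedAll S [] W`. By `countP_feedAll_le` with nothing frozen, the
-- right side has no more than that.
theorem feedAll_ne (h : OpTerminated S Op) {o : A} (ho : o ∈ Op) {u v : List A}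
    (hv : ∀ a ∈ v, a ∉ Op) (W : List A) : feedAll S (u ++ [o]) W ≠ feedAll S v W := by
  intro e
  have h1 := h.countP_feedAll_le W [] v [] (.inl rfl) (by simpa using hv)
  have h2 := h.feedAll_op_append ho u [] W
  simp only [List.append_nil] at h1 h2
  rw [← e, h2] at h1
  simp [ho] at h1
  omega

theorem fires_data (h : OpTerminated S Op) {o : A} {u v : List A} (hu : ∀ a ∈ u, a ∉ Op)
    (hf : Fires S o u v) : ∀ a ∈ v, a ∉ Op := by
  obtain ⟨p, w, r, hm, rfl, rfl⟩ := hf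
  intro a ha
  refine hu a ?_
  rcases List.mem_append.1 ha with ha | ha
  · simp [ha]
  · simp [(h.shape' hm).2.2.subset ha]

/-- Follow `W` up to its first stuck trigger. Stuck on one side only, it contradicts `feedAll_ne`;
stuck on both, the rest of `W` builds the same word above it, and cancellation shows that the stacks
agreed before it. -/
theorem exists_joint_of_feedAll_eq (h : OpTerminated S Op) (W u v : List A)
    (hu : ∀ a ∈ u, a ∉ Op) (hv : ∀ a ∈ v, a ∉ Op) (e : feedAll S u W = feedAll S v W) :
    ∃ t, Relation.ReflTransGen (JointStep S Op) (u, v) (t, t) := by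
  induction W generalizing u v with
  | nil =>
    obtain rfl : u = v := e
    exact ⟨u, .refl⟩
  | cons a W ih =>
    rw [feedAll_cons, feedAll_cons] at e
    by_cases ha : a ∈ Op
    · by_cases h1 : ∃ u', Fires S a u u' <;> by_cases h2 : ∃ v', Fires S a v v'
      · obtain ⟨u', h1⟩ := h1
        obtain ⟨v', h2⟩ := h2
        rw [h.feed_of_fires h1, h.feed_of_fires h2] at e
        obtain ⟨t, ht⟩ := ih u' v' (h.fires_data hu h1) (h.fires_data hv h2) e
        exact ⟨t, .head (.fire a u v u' v' ha h1 h2) ht⟩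
      · obtain ⟨u', h1⟩ := h1
        rw [h.feed_of_fires h1, feed_of_not_fires h2] at e
        exact absurd e.symm (h.feedAll_ne ha (h.fires_data hu h1) W)
      · obtain ⟨v', h2⟩ := h2
        rw [h.feed_of_fires h2, feed_of_not_fires h1] at e
        exact absurd e (h.feedAll_ne ha (h.fires_data hv h2) W)
      · rw [feed_of_not_fires h1, feed_of_not_fires h2] at e
        have e1 := h.feedAll_op_append ha u [] W
        have e2 := h.feedAll_op_append ha v [] W
        simp only [List.append_nil] at e1 e2
        rw [e1, e2] at e
        obtain rfl : u = v := List.append_cancel_right (List.append_cancel_right e)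
        exact ⟨u, .refl⟩
    · rw [h.feed_data ha, h.feed_data ha] at e
      have hd : ∀ u : List A, (∀ b ∈ u, b ∉ Op) → ∀ b ∈ u ++ [a], b ∉ Op := by
        intro u hu b hb
        rcases List.mem_append.1 hb with hb | hb
        · exact hu b hb
        · rw [List.mem_singleton] at hb
          exact hb ▸ ha
      obtain ⟨t, ht⟩ := ih _ _ (hd u hu) (hd v hv) e
      exact ⟨t, .head (.push a u v ha) ht⟩

theorem exists_feedAll_of_joint (h : OpTerminated S Op) {p q : List A × List A}
    (hr : Relation.ReflTransGen (JointStep S Op) p q) :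
    ∃ W, feedAll S p.1 W = q.1 ∧ feedAll S p.2 W = q.2 := by
  induction hr using Relation.ReflTransGen.head_induction_on with
  | refl => exact ⟨[], rfl, rfl⟩
  | head hs _ ih =>
    obtain ⟨W, h1, h2⟩ := ih
    cases hs with
    | push a u v ha =>
      exact ⟨a :: W, by rwa [feedAll_cons, h.feed_data ha], by rwa [feedAll_cons, h.feed_data ha]⟩
    | fire o u v u' v' ho hu hv =>
      exact ⟨o :: W, by rwa [feedAll_cons, h.feed_of_fires hu],
        by rwa [feedAll_cons, h.feed_of_fires hv]⟩

theorem hasCommonTerm_iff (h : OpTerminated S Op) {u v : List A}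
    (hu : ∀ a ∈ u, a ∉ Op) (hv : ∀ a ∈ v, a ∉ Op) :
    HasCommonTerm S u v ↔ ∃ t, Relation.ReflTransGen (JointStep S Op) (u, v) (t, t) := by
  have key : ∀ W, Equivalent S (u ++ W) (v ++ W) ↔ feedAll S u W = feedAll S v W := by
    intro W
    rw [h.equivalent_iff, feedAll_append, feedAll_append, h.feedAll_data u hu,
      h.feedAll_data v hv, List.nil_append, List.nil_append]
  constructor
  · rintro ⟨W, hW⟩
    exact h.exists_joint_of_feedAll_eq W u v hu hv ((key W).1 hW)
  · rintro ⟨t, ht⟩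
    obtain ⟨W, h1, h2⟩ := h.exists_feedAll_of_joint ht
    exact ⟨W, (key W).2 (h1.trans h2.symm)⟩

end OpTerminated

end OpTerminated

end StringRewriting

namespace StringRewriting

/-! ### Two-stack machines as rewriting systems -/

section TwoStack

/-- An instruction of a nondeterministic machine with two stacks. It replaces the top `ctx popL`
of the left stack by `ctx pushL` and the top `topR` of the right stack by `newR`. -/
structure Instr (Γ Q : Type*) where
  ctx : Γ
  popL : List Γ
  src : Q
  pushL : List Γ
  tgt : Q
  topR : List Γ
  addR : List Γ
  newR : List Γ
  topR_ne : topR ≠ []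
  newR_prefix : newR <+: topR ++ addR

/-- A configuration: the left stack, the state and the right stack, with the tops of the stacks at
the ends of the lists. -/
abbrev Config (Γ Q : Type*) := List Γ × Q × List Γ

inductive InstrStep {Γ Q I : Type*} (P : I → Instr Γ Q) : Config Γ Q → Config Γ Q → Prop
  | mk (i : I) (L R : List Γ) : InstrStep P
      (L ++ (P i).ctx :: (P i).popL, (P i).src, R ++ (P i).topR)
      (L ++ (P i).ctx :: (P i).pushL, (P i).tgt, R ++ (P i).newR)

/-- The letters of the rewriting system of a two-stack machine. -/
inductive Letter (Γ Q I : Type*)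
  | sym (a : Γ)
  | state (q : Q)
  | mark (i : I)
  | prep (i : I)
  | exec (i : I)
  | final

namespace Letter

variable {Γ Q I : Type*}

def IsState : Letter Γ Q I → Prop
  | state _ => True
  | _ => False

def IsMark : Letter Γ Q I → Prop
  | mark _ => True
  | _ => False

def IsOp : Letter Γ Q I → Prop
  | prep _ => True
  | exec _ => True
  | final => True
  | _ => False

@[simp] theorem isState_state (q : Q) : (state q : Letter Γ Q I).IsState := trivial
@[simp] theorem not_isState_sym (a : Γ) : ¬ (sym a : Letter Γ Q I).IsState := id
@[simp] theorem not_isState_mark (i : I) : ¬ (mark i : Letter Γ Q I).IsState := id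
@[simp] theorem isMark_mark (i : I) : (mark i : Letter Γ Q I).IsMark := trivial
@[simp] theorem not_isMark_sym (a : Γ) : ¬ (sym a : Letter Γ Q I).IsMark := id
@[simp] theorem not_isMark_state (q : Q) : ¬ (state q : Letter Γ Q I).IsMark := id
@[simp] theorem isOp_prep (i : I) : (prep i : Letter Γ Q I).IsOp := trivial
@[simp] theorem isOp_exec (i : I) : (exec i : Letter Γ Q I).IsOp := trivial
@[simp] theorem isOp_final : (final : Letter Γ Q I).IsOp := trivial
@[simp] theorem not_isOp_sym (a : Γ) : ¬ (sym a : Letter Γ Q I).IsOp := id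
@[simp] theorem not_isOp_state (q : Q) : ¬ (state q : Letter Γ Q I).IsOp := id
@[simp] theorem not_isOp_mark (i : I) : ¬ (mark i : Letter Γ Q I).IsOp := id

theorem sym_injective : Function.Injective (sym : Γ → Letter Γ Q I) :=
  fun _ _ h => by injection h

instance [Finite Γ] [Finite Q] [Finite I] : Finite (Letter Γ Q I) := by
  let f : Letter Γ Q I → (Γ ⊕ Q ⊕ I) ⊕ (I ⊕ I ⊕ Unit)
    | sym a => .inl (.inl a)
    | state q => .inl (.inr (.inl q))
    | mark i => .inl (.inr (.inr i))
    | prep i => .inr (.inl i)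
    | exec i => .inr (.inr (.inl i))
    | final => .inr (.inr (.inr ()))
  refine Finite.of_injective f ?_
  intro a b h
  cases a <;> cases b <;> simp_all [f]

end Letter

/-- Both `x` and `x'` are the first letter with property `p`. This serves to align words at their
state or mark letter. -/
theorem append_cons_inj {A : Type*} (p : A → Prop) {u u' v v' : List A} {x x' : A}
    (hx : p x) (hx' : p x') (hu : ∀ a ∈ u, ¬ p a) (hu' : ∀ a ∈ u', ¬ p a)
    (h : u ++ x :: v = u' ++ x' :: v') : u = u' ∧ x = x' ∧ v = v' := by
  induction u generalizing u' with
  | nil =>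
    cases u' with
    | nil => simpa using h
    | cons a u' =>
      simp only [List.nil_append, List.cons_append, List.cons.injEq] at h
      exact absurd (h.1 ▸ hx) (hu' a (by simp))
  | cons a u ih =>
    cases u' with
    | nil =>
      simp only [List.nil_append, List.cons_append, List.cons.injEq] at h
      exact absurd (h.1 ▸ hx') (hu a (by simp))
    | cons b u' =>
      simp only [List.cons_append, List.cons.injEq] at h
      obtain ⟨rfl, h⟩ := h
      obtain ⟨rfl, h2⟩ := ih (fun a ha => hu a (by simp [ha])) (fun a ha => hu' a (by simp [ha])) h
      exact ⟨rfl, h2⟩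

open Letter

variable {Γ Q I : Type*} (P : I → Instr Γ Q) (bot : Γ) (qf : Q)

/-- The top of the left stack on which `prep i` fires. -/
def prepL (i : I) : List (Letter Γ Q I) :=
  (sym (P i).ctx :: (P i).popL.map sym) ++ state (P i).src :: ((P i).addR.map sym ++ [mark i])

/-- The top of the right stack on which `prep i` fires. -/
def prepR (i : I) : List (Letter Γ Q I) :=
  ((P i).topR.map sym ++ (P i).addR.map sym) ++ [mark i]

/-- The top of the left stack on which `exec i` fires. -/
def execL (i : I) : List (Letter Γ Q I) :=
  (sym (P i).ctx :: (P i).pushL.map sym) ++ [state (P i).tgt]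

/-- The top of the right stack on which `exec i` fires. -/
def execR (i : I) : List (Letter Γ Q I) :=
  ((P i).topR.map sym ++ (P i).addR.map sym) ++
    mark i :: ((P i).pushL.map sym ++ [state (P i).tgt])

/-- One rule per trigger and side. `prep i` erases the popped letters, the state, `addR` and the
mark on the left, but only itself on the right. `exec i` erases only itself on the left; on the
right it cuts back to `newR`, discarding the mark and the letters meant for the left stack. -/
def instrRules (i : I) : FiniteSRS (Letter Γ Q I) :=
  [(prepL P i ++ [prep i], [sym (P i).ctx]), (prepR P i ++ [prep i], prepR P i),
    (execL P i ++ [exec i], execL P i), (execR P i ++ [exec i], (P i).newR.map sym)]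

/-- The rewriting system of a two-stack machine. -/
noncomputable def machineRules [Fintype I] : FiniteSRS (Letter Γ Q I) :=
  (Finset.univ.toList.flatMap (instrRules P)) ++
    [([sym bot, state qf, final], [sym bot]), ([sym bot, final], [sym bot])]

theorem mem_machineRules [Fintype I] {x : Rule (Letter Γ Q I)} : x ∈ machineRules P bot qf ↔
    (∃ i, x ∈ instrRules P i) ∨ x = ([sym bot, state qf] ++ [final], [sym bot]) ∨
      x = ([sym bot] ++ [final], [sym bot]) := by
  simp [machineRules]

variable {P bot qf}

theorem append_singleton_inj {A : Type*} {u v : List A} {a b : A} :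
    u ++ [a] = v ++ [b] ↔ u = v ∧ a = b := by
  constructor
  · intro h
    obtain ⟨h1, h2⟩ := List.append_inj' h rfl
    exact ⟨h1, by simpa using h2⟩
  · rintro ⟨rfl, rfl⟩
    rfl

theorem prep_mem_machineRules [Fintype I] {w r : List (Letter Γ Q I)} {i : I} :
    (w ++ [prep i], r) ∈ machineRules P bot qf ↔
      (w = prepL P i ∧ r = [sym (P i).ctx]) ∨ (w = prepR P i ∧ r = prepR P i) := by
  simp only [mem_machineRules, instrRules, List.mem_cons, Prod.mk.injEq, append_singleton_inj,
    List.not_mem_nil, or_false, prep.injEq, reduceCtorEq, and_false, false_and]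
  constructor
  · rintro ⟨j, ⟨⟨rfl, rfl⟩, rfl⟩ | ⟨⟨rfl, rfl⟩, rfl⟩⟩
    · exact .inl ⟨rfl, rfl⟩
    · exact .inr ⟨rfl, rfl⟩
  · rintro (⟨rfl, rfl⟩ | ⟨rfl, rfl⟩)
    · exact ⟨i, .inl ⟨⟨rfl, rfl⟩, rfl⟩⟩
    · exact ⟨i, .inr ⟨⟨rfl, rfl⟩, rfl⟩⟩

theorem exec_mem_machineRules [Fintype I] {w r : List (Letter Γ Q I)} {i : I} :
    (w ++ [exec i], r) ∈ machineRules P bot qf ↔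
      (w = execL P i ∧ r = execL P i) ∨ (w = execR P i ∧ r = (P i).newR.map sym) := by
  simp only [mem_machineRules, instrRules, List.mem_cons, Prod.mk.injEq, append_singleton_inj,
    List.not_mem_nil, or_false, exec.injEq, reduceCtorEq, and_false, false_and, false_or]
  constructor
  · rintro ⟨j, ⟨⟨rfl, rfl⟩, rfl⟩ | ⟨⟨rfl, rfl⟩, rfl⟩⟩
    · exact .inl ⟨rfl, rfl⟩
    · exact .inr ⟨rfl, rfl⟩
  · rintro (⟨rfl, rfl⟩ | ⟨rfl, rfl⟩)
    · exact ⟨i, .inl ⟨⟨rfl, rfl⟩, rfl⟩⟩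
    · exact ⟨i, .inr ⟨⟨rfl, rfl⟩, rfl⟩⟩

theorem final_mem_machineRules [Fintype I] {w r : List (Letter Γ Q I)} :
    (w ++ [final], r) ∈ machineRules P bot qf ↔
      (w = [sym bot, state qf] ∧ r = [sym bot]) ∨ (w = [sym bot] ∧ r = [sym bot]) := by
  simp only [mem_machineRules, instrRules, List.mem_cons, Prod.mk.injEq, append_singleton_inj,
    List.not_mem_nil, or_false, reduceCtorEq, and_false, false_and, false_or, exists_false,
    and_true]

theorem prepL_not_suffix (i : I) : ¬ prepL P i <:+ prepR P i := by
  intro h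
  have : (state (P i).src : Letter Γ Q I) ∈ prepR P i := h.subset (by simp [prepL])
  simp [prepR] at this

/-- As `topR` is nonempty, a symbol precedes `addR` here, where `prepL` has the state. -/
theorem prepR_not_suffix (i : I) : ¬ prepR P i <:+ prepL P i := by
  rintro ⟨t, h⟩
  obtain ⟨y, b, hy⟩ := (List.eq_nil_or_concat (P i).topR).resolve_left (P i).topR_ne
  simp only [prepL, prepR, hy] at h
  have h' : t ++ (y.map sym ++ [sym b]) =
      sym (P i).ctx :: (P i).popL.map sym ++ [state (P i).src] := by
    apply List.append_cancel_right (bs := (P i).addR.map sym ++ [mark i])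
    simpa using h
  rw [← List.append_assoc, append_singleton_inj] at h'
  simp at h'

theorem execR_not_suffix (i : I) : ¬ execR P i <:+ execL P i := by
  intro h
  have : (mark i : Letter Γ Q I) ∈ execL P i := h.subset (by simp [execR])
  simp [execL] at this

/-- This is what the context letter is for: `pushL` is preceded by `ctx` in one word and by `mark i`
in the other. -/
theorem execL_not_suffix (i : I) : ¬ execL P i <:+ execR P i := by
  rintro ⟨t, h⟩
  have h' : t ++ [sym (P i).ctx] = (P i).topR.map sym ++ (P i).addR.map sym ++ [mark i] := by
    apply List.append_cancel_right (bs := (P i).pushL.map sym ++ [state (P i).tgt])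
    simpa [execL, execR] using h
  rw [append_singleton_inj] at h'
  simp at h'

theorem machineRules_opTerminated [Fintype I] :
    OpTerminated (machineRules P bot qf) {a : Letter Γ Q I | a.IsOp} where
  shape := by
    intro l r hm
    rw [mem_machineRules] at hm
    rcases hm with ⟨i, hm⟩ | h | h
    · simp only [instrRules, List.mem_cons, Prod.mk.injEq, List.not_mem_nil, or_false] at hm
      rcases hm with ⟨rfl, rfl⟩ | ⟨rfl, rfl⟩ | ⟨rfl, rfl⟩ | ⟨rfl, rfl⟩
      · refine ⟨_, _, rfl, by simp, ?_, by simp [prepL]⟩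
        simp [prepL, or_imp, forall_and]
      · refine ⟨_, _, rfl, by simp, ?_, List.prefix_rfl⟩
        simp [prepR, or_imp, forall_and]
      · refine ⟨_, _, rfl, by simp, ?_, List.prefix_rfl⟩
        simp [execL, or_imp, forall_and]
      · refine ⟨_, _, rfl, by simp, ?_, ?_⟩
        · simp [execR, or_imp, forall_and]
        · rw [execR, ← List.map_append]
          exact ((P i).newR_prefix.map sym).trans (List.prefix_append _ _)
    · obtain ⟨rfl, rfl⟩ := Prod.mk.inj h
      exact ⟨_, _, rfl, by simp, by simp, by simp⟩
    · obtain ⟨rfl, rfl⟩ := Prod.mk.inj h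
      exact ⟨_, _, rfl, by simp, by simp, by simp⟩
  unique := by
    intro w w' r r' o h1 h2 hs
    cases o with
    | prep i =>
      rw [prep_mem_machineRules] at h1 h2
      rcases h1 with ⟨rfl, rfl⟩ | ⟨rfl, rfl⟩ <;> rcases h2 with ⟨rfl, rfl⟩ | ⟨rfl, rfl⟩
      · exact ⟨rfl, rfl⟩
      · exact absurd hs (prepL_not_suffix i)
      · exact absurd hs (prepR_not_suffix i)
      · exact ⟨rfl, rfl⟩
    | exec i =>
      rw [exec_mem_machineRules] at h1 h2
      rcases h1 with ⟨rfl, rfl⟩ | ⟨rfl, rfl⟩ <;> rcases h2 with ⟨rfl, rfl⟩ | ⟨rfl, rfl⟩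
      · exact ⟨rfl, rfl⟩
      · exact absurd hs (execL_not_suffix i)
      · exact absurd hs (execR_not_suffix i)
      · exact ⟨rfl, rfl⟩
    | final =>
      rw [final_mem_machineRules] at h1 h2
      rcases h1 with ⟨rfl, rfl⟩ | ⟨rfl, rfl⟩ <;> rcases h2 with ⟨rfl, rfl⟩ | ⟨rfl, rfl⟩
      · exact ⟨rfl, rfl⟩
      · exact absurd hs.length_le (by simp)
      · obtain ⟨t, ht⟩ := hs
        have : t ++ [sym bot] = [sym bot] ++ [state qf] := ht
        rw [append_singleton_inj] at this
        simp at this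
      · exact ⟨rfl, rfl⟩
    | sym | state | mark =>
      simp only [mem_machineRules, instrRules, List.mem_cons, Prod.mk.injEq, append_singleton_inj,
        List.not_mem_nil, or_false, reduceCtorEq, and_false, false_and, exists_false] at h1

theorem joint_push (S : FiniteSRS (Letter Γ Q I)) (D : List (Letter Γ Q I))
    (hD : ∀ a ∈ D, ¬ a.IsOp) (u v : List (Letter Γ Q I)) :
    Relation.ReflTransGen (JointStep S {a | a.IsOp}) (u, v) (u ++ D, v ++ D) := by
  induction D generalizing u v with
  | nil => simpa using Relation.ReflTransGen.refl
  | cons a D ih =>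
    have h := ih (fun b hb => hD b (by simp [hb])) (u ++ [a]) (v ++ [a])
    simp only [List.append_assoc, List.singleton_append] at h
    exact .head (.push a u v (hD a (by simp))) h

/-- The left string of the instance of the common term problem for a configuration. -/
def leftWord (I : Type*) (c : Config Γ Q) : List (Letter Γ Q I) := c.1.map sym ++ [state c.2.1]

/-- The right string of the instance of the common term problem for a configuration. -/
def rightWord (I : Type*) (c : Config Γ Q) : List (Letter Γ Q I) := c.2.2.map sym

/-- The word fed for instruction `i` is `addR`, `mark i`, `prep i`, `pushL`, `tgt`, `exec i`. -/
theorem joint_of_instrStep [Fintype I] {c d : Config Γ Q} (h : InstrStep P c d) :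
    Relation.ReflTransGen (JointStep (machineRules P bot qf) {a | a.IsOp})
      (leftWord I c, rightWord I c) (leftWord I d, rightWord I d) := by
  obtain ⟨i, L, R⟩ := h
  simp only [leftWord, rightWord]
  refine (joint_push _ ((P i).addR.map sym ++ [mark i])
    (by simp [or_imp, forall_and]) _ _).trans ?_
  refine .head (.fire (prep i) _ _ (L.map sym ++ [sym (P i).ctx]) (R.map sym ++ prepR P i)
    trivial ⟨L.map sym, prepL P i, _, prep_mem_machineRules.2 (.inl ⟨rfl, rfl⟩), ?_, rfl⟩
    ⟨R.map sym, prepR P i, _, prep_mem_machineRules.2 (.inr ⟨rfl, rfl⟩), ?_, rfl⟩) ?_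
  · simp [prepL]
  · simp [prepR]
  refine (joint_push _ ((P i).pushL.map sym ++ [state (P i).tgt])
    (by simp [or_imp, forall_and]) _ _).trans ?_
  refine .single (.fire (exec i) _ _ _ _
    trivial ⟨L.map sym, execL P i, _, exec_mem_machineRules.2 (.inl ⟨rfl, rfl⟩), ?_, ?_⟩
    ⟨R.map sym, execR P i, _, exec_mem_machineRules.2 (.inr ⟨rfl, rfl⟩), ?_, ?_⟩)
  · simp [execL]
  · simp [execL]
  · simp [prepR, execR]
  · simp

theorem joint_of_reaches [Fintype I] {c d : Config Γ Q} (h : Relation.ReflTransGen (InstrStep P) c d) :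
    Relation.ReflTransGen (JointStep (machineRules P bot qf) {a | a.IsOp})
      (leftWord I c, rightWord I c) (leftWord I d, rightWord I d) := by
  induction h with
  | refl => exact .refl
  | tail _ hs ih => exact ih.trans (joint_of_instrStep hs)

theorem isOp_leftWord (c : Config Γ Q) : ∀ a ∈ leftWord I c, a ∉ {a : Letter Γ Q I | a.IsOp} := by
  simp [leftWord, or_imp, forall_and]

theorem isOp_rightWord (c : Config Γ Q) :
    ∀ a ∈ rightWord I c, a ∉ {a : Letter Γ Q I | a.IsOp} := by
  simp [rightWord]

theorem hasCommonTerm_of_reaches [Fintype I] {c : Config Γ Q}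
    (h : Relation.ReflTransGen (InstrStep P) c ([bot], qf, [bot])) :
    HasCommonTerm (machineRules P bot qf) (leftWord I c) (rightWord I c) := by
  rw [machineRules_opTerminated.hasCommonTerm_iff (isOp_leftWord c) (isOp_rightWord c)]
  refine ⟨[sym bot], (joint_of_reaches h).tail ?_⟩
  exact .fire final _ _ _ _ trivial
    ⟨[], _, _, final_mem_machineRules.2 (.inl ⟨rfl, rfl⟩), rfl, rfl⟩
    ⟨[], _, _, final_mem_machineRules.2 (.inr ⟨rfl, rfl⟩), rfl, rfl⟩

/-- A rule that fires on two stacks with a common top `D` fires within `D`, or its left-hand side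
reaches below `D` on both stacks. -/
theorem OpTerminated.fires_append {A : Type*} {S : FiniteSRS A} {Op : Set A}
    (h : OpTerminated S Op) {o : A} {u v D u' v' : List A}
    (h1 : Fires S o (u ++ D) u') (h2 : Fires S o (v ++ D) v') :
    (∃ D', u' = u ++ D' ∧ v' = v ++ D') ∨
      ∃ p x r q y s, x ≠ [] ∧ y ≠ [] ∧ u = p ++ x ∧ v = q ++ y ∧ u' = p ++ r ∧ v' = q ++ s ∧
        (x ++ D ++ [o], r) ∈ S ∧ (y ++ D ++ [o], s) ∈ S := by
  have key : ∀ u u', Fires S o (u ++ D) u' →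
      (∃ D', Fires S o D D') ∨ ∃ p x r, x ≠ [] ∧ u = p ++ x ∧ u' = p ++ r ∧
        (x ++ D ++ [o], r) ∈ S := by
    rintro u u' ⟨p, w, r, hm, e, rfl⟩
    rcases List.suffix_or_suffix_of_suffix (List.suffix_append u D)
      (e ▸ List.suffix_append p w) with ⟨x, rfl⟩ | ⟨d, rfl⟩
    · rcases eq_or_ne x [] with rfl | hx
      · exact .inl ⟨[] ++ r, [], D, r, hm, rfl, rfl⟩
      · refine .inr ⟨p, x, r, hx, ?_, rfl, hm⟩
        apply List.append_cancel_right (bs := D)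
        simpa using e
    · exact .inl ⟨d ++ r, d, w, r, hm, rfl, rfl⟩
  have lift : ∀ u u' D', Fires S o (u ++ D) u' → Fires S o D D' → u' = u ++ D' := by
    rintro u u' D' hf ⟨d, w, r, hm, rfl, rfl⟩
    exact h.fires_unique hf ⟨u ++ d, w, r, hm, by simp, by simp⟩
  rcases key u u' h1 with ⟨D', hD⟩ | ⟨p, x, r, hx, e1, e2, e3⟩
  · exact .inl ⟨D', lift _ _ _ h1 hD, lift _ _ _ h2 hD⟩
  · rcases key v v' h2 with ⟨D', hD⟩ | ⟨q, y, s, hy, e4, e5, e6⟩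
    · exact .inl ⟨D', lift _ _ _ h1 hD, lift _ _ _ h2 hD⟩
    · exact .inr ⟨p, x, r, q, y, s, hx, hy, e1, e4, e2, e5, e3, e6⟩

/-- The pairs of strings that occur while the computation from `c` is followed. -/
inductive Tracks (P : I → Instr Γ Q) (c : Config Γ Q) :
    List (Letter Γ Q I) × List (Letter Γ Q I) → Prop
  | rest (d : Config Γ Q) (D : List (Letter Γ Q I)) (h : Relation.ReflTransGen (InstrStep P) c d) :
      Tracks P c (leftWord I d ++ D, rightWord I d ++ D)
  | busy (i : I) (L R : List Γ) (D : List (Letter Γ Q I))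
      (h : Relation.ReflTransGen (InstrStep P) c
        (L ++ (P i).ctx :: (P i).popL, (P i).src, R ++ (P i).topR)) :
      Tracks P c ((L ++ [(P i).ctx]).map sym ++ D, (R.map sym ++ prepR P i) ++ D)

theorem eq_map_sym_of_suffix {B : List Γ} {q y : List (Letter Γ Q I)}
    (h : B.map sym = q ++ y) : ∃ B0 B1, B = B0 ++ B1 ∧ q = B0.map sym ∧ y = B1.map sym := by
  obtain ⟨B0, B1, e, e0, e1⟩ := List.map_eq_append_iff.1 h
  exact ⟨B0, B1, e, e0.symm, e1.symm⟩

theorem eq_append_singleton_of_suffix {A : Type*} {u p x : List A} {a : A} (hx : x ≠ [])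
    (h : u ++ [a] = p ++ x) : ∃ x', x = x' ++ [a] ∧ u = p ++ x' := by
  obtain ⟨x', b, e⟩ := (List.eq_nil_or_concat x).resolve_left hx
  obtain rfl : x = x' ++ [b] := by simpa using e
  rw [← List.append_assoc, append_singleton_inj] at h
  obtain ⟨h, rfl⟩ := h
  exact ⟨x', rfl, h⟩

/-- A nonempty `x` ends in the state letter, so the left rule contains it, while the part of the
right string below `D` has no state. Matching the state positions determines `D` and leaves only the
two rules of `prep i`, unless the state is final. -/
theorem Tracks.rest_fire [Fintype I] {c d : Config Γ Q} (h : Relation.ReflTransGen (InstrStep P) c d)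
    {o : Letter Γ Q I} {D p x r q y s : List (Letter Γ Q I)} (hx : x ≠ [])
    (e1 : leftWord I d = p ++ x) (e2 : rightWord I d = q ++ y)
    (hr : (x ++ D ++ [o], r) ∈ machineRules P bot qf)
    (hs : (y ++ D ++ [o], s) ∈ machineRules P bot qf) :
    Tracks P c (p ++ r, q ++ s) ∨ d.2.1 = qf := by
  obtain ⟨A, st, B⟩ := d
  simp only [leftWord, rightWord] at e1 e2
  obtain ⟨x', rfl, e3⟩ := eq_append_singleton_of_suffix hx e1
  obtain ⟨A0, A1, rfl, rfl, rfl⟩ := eq_map_sym_of_suffix e3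
  obtain ⟨B0, B1, rfl, rfl, rfl⟩ := eq_map_sym_of_suffix e2
  have nostate : ∀ C : List Γ, ∀ a ∈ C.map (sym : Γ → Letter Γ Q I), ¬ a.IsState := by simp
  cases o with
  | sym | state | mark =>
    exact absurd (machineRules_opTerminated.shape' hr).1 (by simp)
  | prep i =>
    rw [prep_mem_machineRules] at hr hs
    rcases hr with ⟨e, rfl⟩ | ⟨e, rfl⟩
    · have e' : A1.map sym ++ state st :: D = prepL P i := by simpa using e
      obtain ⟨f1, f2, rfl⟩ := append_cons_inj IsState (by simp) (by simp) (nostate _)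
        (nostate ((P i).ctx :: (P i).popL)) e'
      obtain rfl : A1 = (P i).ctx :: (P i).popL := List.map_injective_iff.2 sym_injective f1
      injection f2 with f2
      subst f2
      rcases hs with ⟨g, rfl⟩ | ⟨g, rfl⟩
      · exfalso
        have : (state (P i).src : Letter Γ Q I) ∈ B1.map sym ++ ((P i).addR.map sym ++ [mark i]) := by
          rw [g]; simp [prepL]
        simp at this
      · have g' : B1.map (sym : Γ → Letter Γ Q I) = (P i).topR.map sym := by
          apply List.append_cancel_right (bs := (P i).addR.map sym ++ [mark i])
          simpa [prepR] using g
        obtain rfl := List.map_injective_iff.2 sym_injective g'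
        left
        have := Tracks.busy i A0 B0 [] h
        simpa using this
    · exfalso
      have : (state st : Letter Γ Q I) ∈ prepR P i := by rw [← e]; simp
      simp [prepR] at this
  | exec i =>
    exfalso
    rw [exec_mem_machineRules] at hr hs
    have hst : ∃ q', state q' ∈ B1.map sym ++ D := by
      rcases hs with ⟨g, -⟩ | ⟨g, -⟩
      · exact ⟨(P i).tgt, by rw [g]; simp [execL]⟩
      · exact ⟨(P i).tgt, by rw [g]; simp [execR]⟩
    -- In both left-hand sides for `exec i` the only state letter comes last before the trigger. So
    -- nothing follows the state on the left, and the right string cannot supply the state that its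
    -- rule needs.
    have hD : D = [] := by
      rcases hr with ⟨e, -⟩ | ⟨e, -⟩
      · have e' : A1.map sym ++ state st :: D =
            ((P i).ctx :: (P i).pushL).map sym ++ state (P i).tgt :: [] := by
          simpa [execL] using e
        exact (append_cons_inj IsState (by simp) (by simp) (nostate _) (nostate _) e').2.2
      · have e' : A1.map sym ++ state st :: D = ((P i).topR.map sym ++ (P i).addR.map sym ++
            mark i :: (P i).pushL.map sym) ++ state (P i).tgt :: [] := by
          simpa [execR] using e
        exact (append_cons_inj IsState (by simp) (by simp) (nostate _)
          (by simp [or_imp, forall_and]) e').2.2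
    subst hD
    obtain ⟨q', hq⟩ := hst
    simp at hq
  | final =>
    right
    rw [final_mem_machineRules] at hr
    rcases hr with ⟨e, -⟩ | ⟨e, -⟩
    · have : (state st : Letter Γ Q I) ∈ [sym bot, state qf] := by rw [← e]; simp
      simpa using this
    · have : (state st : Letter Γ Q I) ∈ [sym bot] := by rw [← e]; simp
      simp at this

/-- Now `y` ends in `mark i`, and the left string has no mark below `D`. For `prep j` the mark would
be last, so `D` would be empty and the left rule would lack its mark. For `exec j` the marks agree,
`D` is `pushL` with the new state, and the instruction is completed. -/
theorem Tracks.busy_fire [Fintype I] {c : Config Γ Q} {i : I} {L R : List Γ}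
    (h : Relation.ReflTransGen (InstrStep P) c
        (L ++ (P i).ctx :: (P i).popL, (P i).src, R ++ (P i).topR))
    {o : Letter Γ Q I} {D p x r q y s : List (Letter Γ Q I)} (hy : y ≠ [])
    (e1 : (L ++ [(P i).ctx]).map sym = p ++ x) (e2 : R.map sym ++ prepR P i = q ++ y)
    (hr : (x ++ D ++ [o], r) ∈ machineRules P bot qf)
    (hs : (y ++ D ++ [o], s) ∈ machineRules P bot qf) :
    Tracks P c (p ++ r, q ++ s) := by
  have e2' : (R ++ (P i).topR ++ (P i).addR).map sym ++ [mark i] = q ++ y := by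
    simpa [prepR] using e2
  obtain ⟨y', rfl, e3⟩ := eq_append_singleton_of_suffix hy e2'
  obtain ⟨A0, A1, eA, rfl, rfl⟩ := eq_map_sym_of_suffix e1
  obtain ⟨B0, B1, eB, rfl, rfl⟩ := eq_map_sym_of_suffix e3
  have nomark : ∀ C : List Γ, ∀ a ∈ C.map (sym : Γ → Letter Γ Q I), ¬ a.IsMark := by simp
  cases o with
  | sym | state | mark =>
    exact absurd (machineRules_opTerminated.shape' hr).1 (by simp)
  | prep j =>
    exfalso
    rw [prep_mem_machineRules] at hr hs
    have hD : D = [] := by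
      rcases hs with ⟨e, -⟩ | ⟨e, -⟩
      · have e' : B1.map sym ++ mark i :: D = ((P j).ctx :: (P j).popL).map sym ++
            state (P j).src :: (P j).addR.map sym ++ mark j :: [] := by
          simpa [prepL] using e
        exact (append_cons_inj IsMark (by simp) (by simp) (nomark _)
          (by simp [or_imp, forall_and]) e').2.2
      · have e' : B1.map sym ++ mark i :: D =
            ((P j).topR ++ (P j).addR).map sym ++ mark j :: [] := by
          simpa [prepR] using e
        exact (append_cons_inj IsMark (by simp) (by simp) (nomark _) (nomark _) e').2.2
    subst hD
    have : (mark j : Letter Γ Q I) ∈ A1.map sym ++ [] := by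
      rcases hr with ⟨e, -⟩ | ⟨e, -⟩ <;> rw [e]
      · simp [prepL]
      · simp [prepR]
    simp at this
  | exec j =>
    rw [exec_mem_machineRules] at hr hs
    rcases hs with ⟨e, -⟩ | ⟨e, rfl⟩
    · exfalso
      have : (mark i : Letter Γ Q I) ∈ execL P j := by rw [← e]; simp
      simp [execL] at this
    · have e' : B1.map sym ++ mark i :: D = ((P j).topR ++ (P j).addR).map sym ++
          mark j :: ((P j).pushL.map sym ++ [state (P j).tgt]) := by
        simpa [execR] using e
      obtain ⟨f1, f2, rfl⟩ := append_cons_inj IsMark (by simp) (by simp) (nomark _) (nomark _) e'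
      injection f2 with f2
      subst f2
      obtain rfl := List.map_injective_iff.2 sym_injective f1
      rcases hr with ⟨g, rfl⟩ | ⟨g, -⟩
      · have g' : A1.map (sym : Γ → Letter Γ Q I) = [(P i).ctx].map sym := by
          apply List.append_cancel_right (bs := (P i).pushL.map sym ++ [state (P i).tgt])
          simpa [execL] using g
        obtain rfl := List.map_injective_iff.2 sym_injective g'
        obtain rfl : L = A0 := List.append_cancel_right eA
        obtain rfl : R = B0 := by
          rw [List.append_assoc] at eB
          exact List.append_cancel_right eB
        have := Tracks.rest _ [] (h.tail (.mk i L R))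
        simpa [leftWord, rightWord, execL] using this
      · exfalso
        have : (mark i : Letter Γ Q I) ∈ A1.map sym ++ ((P i).pushL.map sym ++ [state (P i).tgt]) := by
          rw [g]; simp [execR]
        simp at this
  | final =>
    exfalso
    rw [final_mem_machineRules] at hs
    rcases hs with ⟨e, -⟩ | ⟨e, -⟩
    · have : (mark i : Letter Γ Q I) ∈ [sym bot, state qf] := by rw [← e]; simp
      simp at this
    · have : (mark i : Letter Γ Q I) ∈ [sym bot] := by rw [← e]; simp
      simp at this

theorem Tracks.jointStep [Fintype I] {c : Config Γ Q} {s t : List (Letter Γ Q I) × List (Letter Γ Q I)}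
    (hs : Tracks P c s) (hst : JointStep (machineRules P bot qf) {a | a.IsOp} s t) :
    Tracks P c t ∨ ∃ d, Relation.ReflTransGen (InstrStep P) c d ∧ d.2.1 = qf := by
  cases hst with
  | push a u v ha =>
    left
    generalize hp : (u, v) = s at hs
    cases hs with
    | rest d D h =>
      obtain ⟨rfl, rfl⟩ := Prod.mk.inj hp
      simpa using Tracks.rest d (D ++ [a]) h
    | busy i L R D h =>
      obtain ⟨rfl, rfl⟩ := Prod.mk.inj hp
      rw [List.append_assoc, List.append_assoc]
      exact Tracks.busy i L R (D ++ [a]) h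
  | fire o u v u' v' ho hu hv =>
    generalize hp : (u, v) = s at hs
    cases hs with
    | rest d D h =>
      obtain ⟨rfl, rfl⟩ := Prod.mk.inj hp
      rcases machineRules_opTerminated.fires_append hu hv with
        ⟨D', rfl, rfl⟩ | ⟨p, x, r, q, y, s, hx, hy, e1, e2, rfl, rfl, hr, hs⟩
      · exact .inl (.rest d D' h)
      · exact (Tracks.rest_fire h hx e1 e2 hr hs).imp_right fun hq => ⟨d, h, hq⟩
    | busy i L R D h =>
      obtain ⟨rfl, rfl⟩ := Prod.mk.inj hp
      rcases machineRules_opTerminated.fires_append hu hv with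
        ⟨D', rfl, rfl⟩ | ⟨p, x, r, q, y, s, hx, hy, e1, e2, rfl, rfl, hr, hs⟩
      · exact .inl (.busy i L R D' h)
      · exact .inl (Tracks.busy_fire h hy e1 e2 hr hs)

theorem Tracks.ne {c : Config Γ Q} {s : List (Letter Γ Q I) × List (Letter Γ Q I)}
    (hs : Tracks P c s) : s.1 ≠ s.2 := by
  cases hs with
  | rest d D h =>
    intro e
    have e := List.append_cancel_right e
    have : state d.2.1 ∈ rightWord I d := by rw [← e]; simp [leftWord]
    simp [rightWord] at this
  | busy i L R D h =>
    intro e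
    have e := List.append_cancel_right e
    have : (mark i : Letter Γ Q I) ∈ (L ++ [(P i).ctx]).map (sym : Γ → Letter Γ Q I) := by rw [e]; simp [prepR]
    simp at this

/-- Nothing is claimed about the stacks of `d`. The gap to `hasCommonTerm_of_reaches` closes for a
machine that can empty its stacks in the final state. -/
theorem reaches_of_hasCommonTerm [Fintype I] {c : Config Γ Q}
    (h : HasCommonTerm (machineRules P bot qf) (leftWord I c) (rightWord I c)) :
    ∃ d, Relation.ReflTransGen (InstrStep P) c d ∧ d.2.1 = qf := by
  rw [machineRules_opTerminated.hasCommonTerm_iff (isOp_leftWord c) (isOp_rightWord c)] at h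
  obtain ⟨t, ht⟩ := h
  have key : ∀ s, Relation.ReflTransGen (JointStep (machineRules P bot qf) {a | a.IsOp})
      (leftWord I c, rightWord I c) s →
      Tracks P c s ∨ ∃ d, Relation.ReflTransGen (InstrStep P) c d ∧ d.2.1 = qf := by
    intro s hs
    induction hs with
    | refl => left; simpa using Tracks.rest (P := P) c [] .refl
    | tail _ hst ih =>
      rcases ih with ih | ih
      · exact ih.jointStep hst
      · exact .inr ih
  exact (key _ ht).resolve_left fun hs => hs.ne rfl

end TwoStack

end StringRewriting

namespace StringRewriting

/-! ### Simulation of a Turing machine by a two-stack machine -/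

section Simulation

open Turing Turing.TM0

variable {Γ Λ : Type*}

/-- The indices of the instructions of the two-stack machine that simulates a Turing machine. -/
inductive SimIndex (Γ Λ : Type*) (T : Set Λ)
  | extendL (q : Option T) (d : Option Γ)
  | extendR (q : Option T) (c : Option Γ)
  | run (q : T) (a e : Γ) (c d : Option Γ)
  | cleanL (a : Γ) (c d : Option Γ)
  | cleanR (e : Γ) (c : Option Γ)

instance {T : Set Λ} [Finite Γ] [Finite T] : Finite (SimIndex Γ Λ T) := by
  let f : SimIndex Γ Λ T → (Option T × Option Γ) ⊕ (Option T × Option Γ) ⊕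
      (T × Γ × Γ × Option Γ × Option Γ) ⊕ (Γ × Option Γ × Option Γ) ⊕ (Γ × Option Γ)
    | .extendL q d => .inl (q, d)
    | .extendR q c => .inr (.inl (q, c))
    | .run q a e c d => .inr (.inr (.inl (q, a, e, c, d)))
    | .cleanL a c d => .inr (.inr (.inr (.inl (a, c, d))))
    | .cleanR e c => .inr (.inr (.inr (.inr (e, c))))
  refine Finite.of_injective f ?_
  intro a b h
  cases a <;> cases b <;> simp_all [f]

open Classical in
/-- The state `q` as a state of the simulating machine. -/
noncomputable def simState (T : Set Λ) (q : Λ) : Option T :=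
  if h : q ∈ T then some ⟨q, h⟩ else none

theorem simState_of_mem {T : Set Λ} {q : Λ} (h : q ∈ T) : simState T q = some ⟨q, h⟩ :=
  dif_pos h

/-- The stack that holds the word `l`. -/
def stackOf (l : List Γ) : List (Option Γ) := none :: l.map some

@[simp] theorem stackOf_nil : stackOf ([] : List Γ) = [none] := rfl

@[simp] theorem stackOf_singleton (a : Γ) : stackOf [a] = [none, some a] := rfl

@[simp] theorem stackOf_append_list (l l' : List Γ) :
    stackOf (l ++ l') = stackOf l ++ l'.map some := by
  simp [stackOf]

theorem stackOf_append (l : List Γ) (a : Γ) :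
    stackOf (l ++ [a]) = stackOf l ++ [some a] := by
  simp [stackOf]

theorem stackOf_eq_append (l : List Γ) : ∃ L c, stackOf l = L ++ [c] := by
  obtain ⟨L, c, h⟩ := (List.eq_nil_or_concat (stackOf l)).resolve_left (by simp [stackOf])
  exact ⟨L, c, by simpa using h⟩

theorem eq_of_stackOf_eq_append_some {l : List Γ} {L : List (Option Γ)} {a : Γ}
    (h : stackOf l = L ++ [some a]) : ∃ l', l = l' ++ [a] ∧ L = stackOf l' := by
  rcases List.eq_nil_or_concat l with rfl | ⟨l', b, hl⟩
  · have h' : [] ++ [none] = L ++ [some a] := h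
    rw [append_singleton_inj] at h'
    simp at h'
  · obtain rfl : l = l' ++ [b] := by simpa using hl
    rw [stackOf_append, append_singleton_inj] at h
    obtain ⟨rfl, h⟩ := h
    exact ⟨l', by simpa using h, rfl⟩

theorem eq_of_stackOf_eq_append_none {l : List Γ} {L : List (Option Γ)}
    (h : stackOf l = L ++ [none]) : l = [] ∧ L = [] := by
  rcases List.eq_nil_or_concat l with rfl | ⟨l', b, hl⟩
  · have h' : [] ++ [none] = L ++ [none] := h
    exact ⟨rfl, (append_singleton_inj.1 h').1.symm⟩
  · obtain rfl : l = l' ++ [b] := by simpa using hl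
    rw [stackOf_append, append_singleton_inj] at h
    simp at h

theorem instrStep_of_eq {Q I : Type*} {P : I → Instr Γ Q} (i : I) (L R : List Γ)
    {c d : Config Γ Q} (hc : c = (L ++ (P i).ctx :: (P i).popL, (P i).src, R ++ (P i).topR))
    (hd : d = (L ++ (P i).ctx :: (P i).pushL, (P i).tgt, R ++ (P i).newR)) :
    InstrStep P c d := by
  rw [hc, hd]
  exact .mk i L R

variable [Inhabited Γ]

/-- The tape with the head on the last letter of `l` and with the reverse of `r` to its right. -/
def tapeOf (l r : List Γ) : Tape Γ :=
  Tape.mk' (ListBlank.mk l.reverse).tail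
    ((ListBlank.mk r.reverse).cons (ListBlank.mk l.reverse).head)

theorem tapeOf_append (l r : List Γ) (a : Γ) :
    tapeOf (l ++ [a]) r = Tape.mk' (ListBlank.mk l.reverse) ((ListBlank.mk r.reverse).cons a) := by
  simp [tapeOf]

theorem ListBlank.mk_default : (ListBlank.mk [default] : ListBlank Γ) = ListBlank.mk [] :=
  Quotient.sound' (.inr ⟨1, rfl⟩)

theorem tapeOf_default (r : List Γ) : tapeOf [default] r = tapeOf [] r := by
  simp [tapeOf, ListBlank.mk_default]

theorem tapeOf_default_right (l : List Γ) : tapeOf l [default] = tapeOf l [] := by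
  simp [tapeOf, ListBlank.mk_default]

theorem tapeOf_head (l r : List Γ) (a : Γ) : (tapeOf (l ++ [a]) r).head = a := by
  simp [tapeOf_append]

theorem tapeOf_write (l r : List Γ) (a b : Γ) :
    (tapeOf (l ++ [a]) r).write b = tapeOf (l ++ [b]) r := by
  simp [tapeOf_append]

theorem tapeOf_move_left (l r : List Γ) (a : Γ) :
    (tapeOf (l ++ [a]) r).move Dir.left = tapeOf l (r ++ [a]) := by
  rw [tapeOf_append, Tape.move_left_mk', tapeOf]
  simp

theorem tapeOf_move_right (l r : List Γ) (a e : Γ) :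
    (tapeOf (l ++ [a]) (r ++ [e])).move Dir.right = tapeOf (l ++ [a] ++ [e]) r := by
  rw [tapeOf_append, Tape.move_right_mk', tapeOf_append]
  simp

variable [Inhabited Λ]

/-- The two-stack machine that simulates the Turing machine `M`. The letter `none` marks the
bottoms of the stacks, the head is at the top of the left stack, and the state `none` is entered
when `M` halts. -/
noncomputable def simInstr (M : Machine Γ Λ) (T : Set Λ) :
    SimIndex Γ Λ T → Instr (Option Γ) (Option T)
  | .extendL q d => ⟨none, [], q, [some default], q, [d], [], [d], by simp, by simp⟩
  | .extendR q c => ⟨c, [], q, [], q, [none], [some default], [none, some default], by simp,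
      by simp⟩
  | .run q a e c d =>
    match M q a with
    | none => ⟨c, [some a], some q, [], none, [d], [], [d], by simp, by simp⟩
    | some (q', .write b) =>
      ⟨c, [some a], some q, [some b], simState T q', [d], [], [d], by simp, by simp⟩
    | some (q', .move .right) =>
      ⟨c, [some a], some q, [some a, some e], simState T q', [some e], [], [], by simp, by simp⟩
    | some (q', .move .left) =>
      ⟨c, [some a], some q, [], simState T q', [d], [some a], [d, some a], by simp, by simp⟩
  | .cleanL a c d => ⟨c, [some a], none, [], none, [d], [], [d], by simp, by simp⟩
  | .cleanR e c => ⟨c, [], none, [], none, [some e], [], [], by simp, by simp⟩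

variable {M : Machine Γ Λ} {T : Set Λ}

/-- A configuration of the simulating machine that a computation of `M` from `s` accounts for. -/
def Simulated (M : Machine Γ Λ) (T : Set Λ) (s : TM0.Cfg Γ Λ)
    (c : Config (Option Γ) (Option T)) : Prop :=
  ∃ q l r, Reaches M s ⟨q, tapeOf l r⟩ ∧ q ∈ T ∧ c = (stackOf l, simState T q, stackOf r)

theorem step_tapeOf (q : Λ) (l r : List Γ) (a : Γ) : TM0.step M ⟨q, tapeOf (l ++ [a]) r⟩ =
    (M q a).map fun x => ⟨x.1, match x.2 with
      | .move d => (tapeOf (l ++ [a]) r).move d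
      | .write b => (tapeOf (l ++ [a]) r).write b⟩ := by
  simp only [TM0.step, tapeOf_head]
  congr 1

theorem Simulated.instrStep (hM : Supports M T) {s : TM0.Cfg Γ Λ}
    {c d : Config (Option Γ) (Option T)} (hc : Simulated M T s c)
    (h : InstrStep (simInstr M T) c d) :
    Simulated M T s d ∨ (StateTransition.eval (TM0.step M) s).Dom := by
  obtain ⟨q, l, r, hr, hq, e⟩ := hc
  rw [simState_of_mem hq] at e
  obtain ⟨i, L, R⟩ := h
  obtain ⟨e1, e2⟩ := Prod.mk.inj e
  obtain ⟨e2, e3⟩ := Prod.mk.inj e2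
  clear e
  cases i with
  | extendL q' d =>
    left
    simp only [simInstr] at e1 e2 e3 ⊢
    subst e2
    obtain ⟨rfl, rfl⟩ := eq_of_stackOf_eq_append_none e1.symm
    refine ⟨q, [default], r, ?_, hq, ?_⟩
    · rwa [tapeOf_default]
    · rw [simState_of_mem hq, e3]
      rfl
  | extendR q' c =>
    left
    simp only [simInstr] at e1 e2 e3 ⊢
    subst e2
    obtain ⟨rfl, rfl⟩ := eq_of_stackOf_eq_append_none e3.symm
    refine ⟨q, l, [default], ?_, hq, ?_⟩
    · rwa [tapeOf_default_right]
    · rw [simState_of_mem hq, e1]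
      rfl
  | run q' a e c d =>
    rcases hm : M q' a with _ | ⟨p, st⟩
    · right
      simp only [simInstr, hm] at e1 e2 e3
      obtain rfl : q' = ⟨q, hq⟩ := Option.some.inj e2
      obtain ⟨l, rfl, -⟩ := eq_of_stackOf_eq_append_some (L := L ++ [c]) (by simpa using e1.symm)
      refine Part.dom_iff_mem.2 ⟨_, StateTransition.mem_eval.2 ⟨hr, ?_⟩⟩
      rw [step_tapeOf]
      simp only at hm
      simp [hm]
    · left
      have hp : p ∈ T := hM.2 (by rw [hm]; rfl) q'.2
      have key : ∀ l' r' T', tapeOf l' r' = T' →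
          TM0.step M ⟨q, tapeOf l r⟩ = some ⟨p, T'⟩ →
          Simulated M T s (stackOf l', simState T p, stackOf r') := by
        rintro l' r' T' rfl ht
        exact ⟨p, l', r', hr.tail ht, hp, rfl⟩
      rcases st with (_ | _) | b <;> simp only [simInstr, hm] at e1 e2 e3 ⊢ <;>
        (obtain rfl : q' = ⟨q, hq⟩ := Option.some.inj e2) <;>
        obtain ⟨l, rfl, hl⟩ := eq_of_stackOf_eq_append_some (L := L ++ [c])
          (by simpa using e1.symm) <;>
        simp only [step_tapeOf, hm, Option.map_some, Option.some.injEq] at key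
      · have := key l (r ++ [a]) _ (tapeOf_move_left l r a).symm rfl
        rw [stackOf_append, ← hl, ← e3] at this
        simpa using this
      · obtain ⟨r, rfl, rfl⟩ := eq_of_stackOf_eq_append_some e3.symm
        have := key (l ++ [a] ++ [e]) r _ (tapeOf_move_right l r a e).symm rfl
        rw [stackOf_append, stackOf_append, ← hl] at this
        simpa using this
      · have := key (l ++ [b]) r _ (tapeOf_write l r a b).symm rfl
        rw [stackOf_append, ← hl, ← e3] at this
        simpa using this
  -- Cleaning starts in the state `none`, which encodes no state in `T`.
  | cleanL | cleanR => simp [simInstr] at e2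

theorem eval_dom_of_reaches (hM : Supports M T) {q : Λ} (hq : q ∈ T) (l r : List Γ)
    {d : Config (Option Γ) (Option T)} (h : Relation.ReflTransGen (InstrStep (simInstr M T))
      (stackOf l, simState T q, stackOf r) d) (hd : d.2.1 = none) :
    (StateTransition.eval (TM0.step M) ⟨q, tapeOf l r⟩).Dom := by
  have key : Simulated M T ⟨q, tapeOf l r⟩ d ∨
      (StateTransition.eval (TM0.step M) ⟨q, tapeOf l r⟩).Dom := by
    clear hd
    induction h with
    | refl => exact .inl ⟨q, l, r, .refl, hq, rfl⟩
    | tail _ hs ih =>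
      rcases ih with ih | ih
      · exact ih.instrStep hM hs
      · exact .inr ih
  refine key.resolve_left ?_
  rintro ⟨q', l', r', -, hq', rfl⟩
  simp [simState_of_mem hq'] at hd

/-- If the bottom marker is exposed, an explicit blank is put on it; the tape is unchanged, and
there is now a letter under the head to read. -/
theorem reaches_head (q : Option T) (l r : List Γ) : ∃ l' a, tapeOf (l' ++ [a]) r = tapeOf l r ∧
    Relation.ReflTransGen (InstrStep (simInstr M T)) (stackOf l, q, stackOf r)
      (stackOf (l' ++ [a]), q, stackOf r) := by
  rcases List.eq_nil_or_concat l with rfl | ⟨l', a, hl⟩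
  · obtain ⟨R, d, hd⟩ := stackOf_eq_append r
    refine ⟨[], default, tapeOf_default r, .single ?_⟩
    refine instrStep_of_eq (.extendL q d) [] R ?_ ?_ <;> simp [simInstr, hd]
  · obtain rfl : l = l' ++ [a] := by simpa using hl
    exact ⟨l', a, rfl, .refl⟩

theorem reaches_right (q : Option T) (l r : List Γ) : ∃ r' e, tapeOf l (r' ++ [e]) = tapeOf l r ∧
    Relation.ReflTransGen (InstrStep (simInstr M T)) (stackOf l, q, stackOf r)
      (stackOf l, q, stackOf (r' ++ [e])) := by
  rcases List.eq_nil_or_concat r with rfl | ⟨r', a, hr⟩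
  · obtain ⟨L, c, hc⟩ := stackOf_eq_append l
    refine ⟨[], default, tapeOf_default_right l, .single ?_⟩
    refine instrStep_of_eq (.extendR q c) L [] ?_ ?_ <;> simp [simInstr, hc]
  · obtain rfl : r = r' ++ [a] := by simpa using hr
    exact ⟨r', a, rfl, .refl⟩

theorem reaches_of_step (hM : Supports M T) {q q' : Λ} (hq : q ∈ T) {l r : List Γ} {T' : Tape Γ}
    (h : TM0.step M ⟨q, tapeOf l r⟩ = some ⟨q', T'⟩) : q' ∈ T ∧ ∃ l' r', T' = tapeOf l' r' ∧
      Relation.ReflTransGen (InstrStep (simInstr M T)) (stackOf l, simState T q, stackOf r)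
        (stackOf l', simState T q', stackOf r') := by
  obtain ⟨l, a, e1, h1⟩ := reaches_head (M := M) (simState T q) l r
  obtain ⟨r, e, e2, h2⟩ := reaches_right (M := M) (simState T q) (l ++ [a]) r
  rw [← e1, ← e2, step_tapeOf] at h
  obtain ⟨⟨p, st⟩, hm, h⟩ := Option.map_eq_some_iff.1 h
  obtain ⟨rfl, rfl⟩ := TM0.Cfg.mk.inj h
  refine ⟨hM.2 hm hq, ?_⟩
  suffices hs : ∃ l' r', (match st with
      | .move d => (tapeOf (l ++ [a]) (r ++ [e])).move d
      | .write b => (tapeOf (l ++ [a]) (r ++ [e])).write b) = tapeOf l' r' ∧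
      InstrStep (simInstr M T) (stackOf (l ++ [a]), simState T q, stackOf (r ++ [e]))
        (stackOf l', simState T p, stackOf r') by
    obtain ⟨l', r', hs1, hs2⟩ := hs
    exact ⟨l', r', hs1, (h1.trans h2).tail hs2⟩
  obtain ⟨L, c, hL⟩ := stackOf_eq_append l
  rcases st with (_ | _) | b
  · refine ⟨_, _, tapeOf_move_left _ _ _, ?_⟩
    refine instrStep_of_eq (.run ⟨q, hq⟩ a e c (some e)) L (stackOf r) ?_ ?_ <;>
      simp [simInstr, hm, hL, simState_of_mem hq]
  · refine ⟨_, _, tapeOf_move_right _ _ _ _, ?_⟩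
    refine instrStep_of_eq (.run ⟨q, hq⟩ a e c (some e)) L (stackOf r) ?_ ?_ <;>
      simp [simInstr, hm, hL, simState_of_mem hq]
  · refine ⟨_, _, tapeOf_write _ _ _ _, ?_⟩
    refine instrStep_of_eq (.run ⟨q, hq⟩ a e c (some e)) L (stackOf r) ?_ ?_ <;>
      simp [simInstr, hm, hL, simState_of_mem hq]

theorem reaches_clean_left (l r : List Γ) : Relation.ReflTransGen (InstrStep (simInstr M T))
    (stackOf l, none, stackOf r) (stackOf [], none, stackOf r) := by
  induction l using List.reverseRecOn with
  | nil => exact .refl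
  | append_singleton l a ih =>
    obtain ⟨L, c, hL⟩ := stackOf_eq_append l
    obtain ⟨R, d, hR⟩ := stackOf_eq_append r
    refine .head (instrStep_of_eq (.cleanL a c d) L R ?_ ?_) ih <;> simp [simInstr, hL, hR]

theorem reaches_clean_right (r : List Γ) : Relation.ReflTransGen (InstrStep (simInstr M T))
    (stackOf [], none, stackOf r) (stackOf [], none, stackOf []) := by
  induction r using List.reverseRecOn with
  | nil => exact .refl
  | append_singleton r e ih =>
    refine .head (instrStep_of_eq (.cleanR e none) [] (stackOf r) ?_ ?_) ih <;>
      simp [simInstr, stackOf]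

theorem reaches_of_halt {q : Λ} (hq : q ∈ T) {l r : List Γ}
    (h : TM0.step M ⟨q, tapeOf l r⟩ = none) :
    Relation.ReflTransGen (InstrStep (simInstr M T)) (stackOf l, simState T q, stackOf r)
      ([none], none, [none]) := by
  obtain ⟨l, a, e1, h1⟩ := reaches_head (M := M) (simState T q) l r
  rw [← e1, step_tapeOf, Option.map_eq_none_iff] at h
  obtain ⟨L, c, hL⟩ := stackOf_eq_append l
  obtain ⟨R, d, hR⟩ := stackOf_eq_append r
  -- The index `default` is arbitrary: the halting instruction does not use the letter right of the
  -- head.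
  refine h1.trans (.head (instrStep_of_eq (.run ⟨q, hq⟩ a default c d) L R ?_ ?_)
    ((reaches_clean_left l r).trans (reaches_clean_right r))) <;>
    simp [simInstr, h, hL, hR, simState_of_mem hq]

theorem reaches_of_eval_dom (hM : Supports M T) {q : Λ} (hq : q ∈ T) {l r : List Γ}
    (h : (StateTransition.eval (TM0.step M) ⟨q, tapeOf l r⟩).Dom) :
    Relation.ReflTransGen (InstrStep (simInstr M T)) (stackOf l, simState T q, stackOf r)
      ([none], none, [none]) := by
  obtain ⟨b, hb⟩ := Part.dom_iff_mem.1 h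
  obtain ⟨hr, hn⟩ := StateTransition.mem_eval.1 hb
  have key : ∀ c, StateTransition.Reaches (TM0.step M) ⟨q, tapeOf l r⟩ c →
      c.q ∈ T ∧ ∃ l' r', c.Tape = tapeOf l' r' ∧
        Relation.ReflTransGen (InstrStep (simInstr M T)) (stackOf l, simState T q, stackOf r)
          (stackOf l', simState T c.q, stackOf r') := by
    intro c hc
    induction hc with
    | refl => exact ⟨hq, l, r, rfl, .refl⟩
    | @tail c d _ hs ih =>
      obtain ⟨hc, l', r', e, h1⟩ := ih
      obtain ⟨p, Tc⟩ := c
      obtain ⟨p', Td⟩ := d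
      obtain rfl : Tc = tapeOf l' r' := e
      obtain ⟨hp', l'', r'', e', h2⟩ := reaches_of_step hM hc hs
      exact ⟨hp', l'', r'', e', h1.trans h2⟩
  obtain ⟨hbT, l', r', e, h1⟩ := key b hr
  obtain ⟨p, Tb⟩ := b
  obtain rfl : Tb = tapeOf l' r' := e
  exact h1.trans (reaches_of_halt hbT hn)

theorem hasCommonTerm_simInstr_iff [Fintype (SimIndex Γ Λ T)] (hM : Supports M T) {q : Λ}
    (hq : q ∈ T) (l r : List Γ) :
    HasCommonTerm (machineRules (simInstr M T) none none)
        (leftWord _ (stackOf l, simState T q, stackOf r))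
        (rightWord _ (stackOf l, simState T q, stackOf r)) ↔
      (StateTransition.eval (TM0.step M) ⟨q, tapeOf l r⟩).Dom := by
  constructor
  · intro h
    obtain ⟨d, hd, hd'⟩ := reaches_of_hasCommonTerm h
    exact eval_dom_of_reaches hM hq l r hd hd'
  · intro h
    exact hasCommonTerm_of_reaches (reaches_of_eval_dom hM hq h)

end Simulation

end StringRewriting

namespace StringRewriting

/-! ### A Turing machine with undecidable halting on inputs with one block of varying length -/

section Machine

open Turing
open Nat.Partrec (Code)

theorem not_computablePred_halting :
    ¬ ComputablePred fun n : ℕ => (Code.eval (Denumerable.ofNat Code n) 0).Dom := by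
  rintro ⟨_, h⟩
  refine ComputablePred.halting_problem 0 ⟨fun c => Classical.dec _, ?_⟩
  refine (h.comp Computable.encode).of_eq fun c => ?_
  simp

theorem primrec_two_pow : Primrec fun n : ℕ => 2 ^ n := by
  refine (Primrec.nat_rec₁ 1 (f := fun _ IH => 2 * IH) ?_).of_eq fun n => ?_
  · exact Primrec.nat_mul.comp (Primrec.const 2) Primrec.snd
  · induction n with
    | zero => rfl
    | succ n ih => simp only [pow_succ, ← ih]; ring

/-- Runs the program with code `n` on the input `2 ^ n`. -/
def haltingOfPow (m : ℕ) : Part ℕ :=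
  (Nat.rfind fun k => Part.some (decide (2 ^ k = m))).bind fun k =>
    Code.eval (Denumerable.ofNat Code k) 0

theorem partrec_haltingOfPow : Partrec haltingOfPow := by
  have h1 : Computable₂ fun m k : ℕ => decide (2 ^ k = m) :=
    (Primrec.eq.decide.comp (primrec_two_pow.comp Primrec.snd) Primrec.fst).to_comp
  refine (Partrec.rfind h1.partrec₂).bind ?_
  exact Code.eval_part.comp ((Computable.ofNat Code).comp Computable.snd) (Computable.const 0)

theorem haltingOfPow_dom (n : ℕ) :
    (haltingOfPow (2 ^ n)).Dom ↔ (Code.eval (Denumerable.ofNat Code n) 0).Dom := by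
  have h : (Nat.rfind fun k => Part.some (decide (2 ^ k = 2 ^ n))) = Part.some n := by
    refine Part.eq_some_iff.2 (Nat.mem_rfind.2 ⟨by simp, fun {m} hm => ?_⟩)
    simp [hm.ne]
  rw [haltingOfPow, h, Part.bind_some]

/-- Numerals start with the least digit. Encoding `n` as `2 ^ n` makes the tape depend on `n` only
through the length of a block of equal letters. -/
theorem trNat_two_pow (n : ℕ) : PartrecToTM2.trNat (2 ^ n) =
    List.replicate n PartrecToTM2.Γ'.bit0 ++ [PartrecToTM2.Γ'.bit1] := by
  have h : ∀ n : ℕ, ∃ p : PosNum, (p : ℕ) = 2 ^ n ∧ PartrecToTM2.trPosNum p =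
      List.replicate n PartrecToTM2.Γ'.bit0 ++ [PartrecToTM2.Γ'.bit1] := by
    intro n
    induction n with
    | zero => exact ⟨PosNum.one, rfl, rfl⟩
    | succ n ih =>
      obtain ⟨p, h1, h2⟩ := ih
      refine ⟨p.bit0, ?_, ?_⟩
      · rw [PosNum.cast_bit0, h1, pow_succ]; ring
      · rw [PartrecToTM2.trPosNum, h2]; rfl
  obtain ⟨p, h1, h2⟩ := h n
  have h3 : ((2 ^ n : ℕ) : Num) = Num.pos p := by
    rw [← h1]
    exact Num.of_to_nat (Num.pos p)
  rw [PartrecToTM2.trNat, h3, PartrecToTM2.trNum, h2]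

instance : Finite PartrecToTM2.K' := by
  refine Finite.of_surjective (fun i : Fin 4 => match i with
    | 0 => PartrecToTM2.K'.main
    | 1 => .rev
    | 2 => .aux
    | 3 => .stack) ?_
  rintro (_ | _ | _ | _)
  exacts [⟨0, rfl⟩, ⟨1, rfl⟩, ⟨2, rfl⟩, ⟨3, rfl⟩]

/-- `haltingOfPow` is compiled to a `ToPartrec.Code` and then through the models `TM2`, `TM1` and
`TM0`. Each translation preserves whether the computation halts, and the machine translations keep a
finite supporting set of states. -/
theorem exists_undecidable_machine : ∃ (Γ Λ : Type) (_ : Inhabited Γ) (_ : Inhabited Λ)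
    (_ : Finite Γ) (M : TM0.Machine Γ Λ) (T : Set Λ), T.Finite ∧ TM0.Supports M T ∧
      ∃ x y b : Γ, ¬ ComputablePred fun n : ℕ =>
        (StateTransition.eval (TM0.step M) (TM0.init (x :: y :: List.replicate n b))).Dom := by
  classical
  obtain ⟨c, hc⟩ := ToPartrec.Code.exists_code
    (Nat.Partrec'.part_iff₁.2 partrec_haltingOfPow)
  -- Machines start in the default state, so this choice makes the compiled code `c` the program
  -- that is run.
  let _ : Inhabited PartrecToTM2.Λ' := ⟨PartrecToTM2.trNormal c PartrecToTM2.Cont'.halt⟩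
  have hs2 : TM2.Supports PartrecToTM2.tr
      (PartrecToTM2.codeSupp c PartrecToTM2.Cont'.halt) :=
    PartrecToTM2.tr_supports c PartrecToTM2.Cont'.halt
  have hs1 := TM2to1.tr_supports PartrecToTM2.tr hs2
  have hs0 := TM1to0.tr_supports (TM2to1.tr PartrecToTM2.tr) hs1
  -- A tape cell holds one letter of each stack; initially only the main stack is occupied. The flag
  -- `true` below marks the bottom cell.
  let st (a : PartrecToTM2.Γ') : ∀ _ : PartrecToTM2.K', Option PartrecToTM2.Γ' :=
    Function.update (fun _ => none) PartrecToTM2.K'.main (some a)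
  have : Fintype PartrecToTM2.K' := Fintype.ofFinite _
  refine ⟨TM2to1.Γ' PartrecToTM2.K' (fun _ => PartrecToTM2.Γ'), _, inferInstance, inferInstance,
    inferInstance, TM1to0.tr (TM2to1.tr PartrecToTM2.tr), _, Finset.finite_toSet _, hs0,
    (true, st .cons), (false, st .bit1), (false, st .bit0), ?_⟩
  intro h
  refine not_computablePred_halting (h.of_eq fun n => ?_)
  have hL : TM2to1.trInit PartrecToTM2.K'.main (PartrecToTM2.trList [2 ^ n]) =
      (true, st .cons) :: (false, st .bit1) :: List.replicate n (false, st .bit0) := by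
    have hr : (PartrecToTM2.trList [2 ^ n]).reverse =
        .cons :: .bit1 :: List.replicate n PartrecToTM2.Γ'.bit0 := by
      simp [PartrecToTM2.trList, trNat_two_pow]
    rw [TM2to1.trInit, hr]
    exact congrArg (fun t => (true, st .cons) :: (false, st .bit1) :: t) List.map_replicate
  have hinit : (TM2.init PartrecToTM2.K'.main (PartrecToTM2.trList [2 ^ n]) :
      TM2.Cfg (fun _ : PartrecToTM2.K' => PartrecToTM2.Γ') PartrecToTM2.Λ'
        (Option PartrecToTM2.Γ')) = PartrecToTM2.init c [2 ^ n] := by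
    simp only [TM2.init, PartrecToTM2.init]
    congr 1
    funext k
    cases k <;> rfl
  have e1 := TM1to0.tr_eval (TM2to1.tr PartrecToTM2.tr)
    (TM2to1.trInit PartrecToTM2.K'.main (PartrecToTM2.trList [2 ^ n]))
  have e2 := TM2to1.tr_eval_dom PartrecToTM2.tr PartrecToTM2.K'.main
    (PartrecToTM2.trList [2 ^ n])
  rw [← e1, hL] at e2
  have e3 : (TM2.eval PartrecToTM2.tr PartrecToTM2.K'.main
      (PartrecToTM2.trList [2 ^ n])).Dom ↔
      (StateTransition.eval (TM2.step PartrecToTM2.tr) (PartrecToTM2.init c [2 ^ n])).Dom := by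
    rw [← hinit]
    exact Iff.rfl
  have e4 := hc (2 ^ n ::ᵥ List.Vector.nil)
  rw [PartrecToTM2.tr_eval] at e3
  have e5 : (ToPartrec.Code.eval c [2 ^ n]).Dom ↔ (haltingOfPow (2 ^ n)).Dom :=
    iff_of_eq (congrArg Part.Dom e4)
  exact e2.trans (e3.trans (e5.trans (haltingOfPow_dom n)))

end Machine

end StringRewriting

namespace StringRewriting

/-! ### Renaming of letters -/

section Transport

variable {A B : Type*}

/-- The system `S` with its letters renamed by `f`. -/
def FiniteSRS.rename (f : A → B) (S : FiniteSRS A) : FiniteSRS B :=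
  S.map fun p => (p.1.map f, p.2.map f)

theorem Step.rename (f : A → B) {S : FiniteSRS A} {u v : List A} (h : Step S u v) :
    Step (S.rename f) (u.map f) (v.map f) := by
  obtain ⟨l, r, x, y, hm, rfl, rfl⟩ := h
  exact ⟨l.map f, r.map f, x.map f, y.map f, List.mem_map.2 ⟨_, hm, rfl⟩, by simp, by simp⟩

theorem FiniteSRS.rename_symm_rename (e : A ≃ B) (S : FiniteSRS A) :
    (S.rename e).rename e.symm = S := by
  simp [FiniteSRS.rename, Function.comp_def]

theorem Step.rename_symm (e : A ≃ B) {S : FiniteSRS A} {u v : List B}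
    (h : Step (S.rename e) u v) : Step S (u.map e.symm) (v.map e.symm) := by
  have h' := Step.rename e.symm h
  rwa [FiniteSRS.rename_symm_rename] at h'

theorem Reduces.rename (f : A → B) {S : FiniteSRS A} {u v : List A} (h : Reduces S u v) :
    Reduces (S.rename f) (u.map f) (v.map f) := by
  induction h with
  | refl => exact .refl
  | tail _ hs ih => exact ih.tail (Step.rename f hs)

theorem Equivalent.rename (f : A → B) {S : FiniteSRS A} {u v : List A} (h : Equivalent S u v) :
    Equivalent (S.rename f) (u.map f) (v.map f) := by
  induction h with
  | rel _ _ hs => exact .rel _ _ (Step.rename f hs)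
  | refl => exact .refl _
  | symm _ _ _ ih => exact ih.symm
  | trans _ _ _ _ _ ih1 ih2 => exact ih1.trans _ _ _ ih2

theorem Dwindling.rename (e : A ≃ B) {S : FiniteSRS A} (h : Dwindling S) :
    Dwindling (S.rename e) := by
  intro l r hm
  obtain ⟨⟨l, r⟩, hm', he⟩ := List.mem_map.1 hm
  obtain ⟨rfl, rfl⟩ := Prod.mk.inj he
  obtain ⟨hp, hne⟩ := h l r hm'
  exact ⟨hp.map e, fun h' => hne (List.map_injective_iff.2 e.injective h')⟩

theorem Convergent.rename (e : A ≃ B) {S : FiniteSRS A} (h : Convergent S) :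
    Convergent (S.rename e) := by
  refine ⟨fun ⟨t, ht⟩ => h.1 ⟨fun n => (t n).map e.symm, fun n => (ht n).rename_symm e⟩, ?_⟩
  intro t s₁ s₂ h1 h2
  have h1' := Reduces.rename e.symm h1
  have h2' := Reduces.rename e.symm h2
  rw [FiniteSRS.rename_symm_rename] at h1' h2'
  obtain ⟨t', h3, h4⟩ := h.2 _ _ _ h1' h2'
  refine ⟨t'.map e, ?_, ?_⟩
  · simpa using Reduces.rename e h3
  · simpa using Reduces.rename e h4

theorem HasCommonTerm.rename (f : A → B) {S : FiniteSRS A} {α β : List A}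
    (h : HasCommonTerm S α β) : HasCommonTerm (S.rename f) (α.map f) (β.map f) := by
  obtain ⟨W, hW⟩ := h
  exact ⟨W.map f, by simpa using Equivalent.rename f hW⟩

theorem hasCommonTerm_rename_iff (e : A ≃ B) {S : FiniteSRS A} {α β : List A} :
    HasCommonTerm (S.rename e) (α.map e) (β.map e) ↔ HasCommonTerm S α β := by
  refine ⟨fun h => ?_, HasCommonTerm.rename e⟩
  simpa [FiniteSRS.rename_symm_rename, Function.comp_def] using HasCommonTerm.rename e.symm h

end Transport

/-! ### The undecidable instances -/

section Undecidability

open Turing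

theorem computablePred_of_decider {X : Type*} [Primcodable X] {decider : X →. Bool}
    (hd : Partrec decider) {f : ℕ → X} (hf : Computable f) {p : ℕ → Prop}
    (h : ∀ n, ∃ answer : Bool, answer ∈ decider (f n) ∧ (answer = true ↔ p n)) :
    ComputablePred p := by
  choose g hg hp using h
  refine ComputablePred.computable_iff.2 ⟨g, ?_, ?_⟩
  · exact Partrec.of_eq_tot (hd.comp hf) hg
  · funext n
    exact propext (hp n).symm

theorem encodeString_eq_map {k : ℕ} (w : List (Fin k)) :
    encodeString w = w.map Fin.val := by
  induction w with
  | nil => rfl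
  | cons a w ih => simpa [encodeString] using ih

theorem computable_append_replicate {X : Type*} [Primcodable X] (x y : List X) (b : X) :
    Computable fun n : ℕ => x ++ (List.replicate n b ++ y) := by
  have h : Primrec fun n : ℕ => List.replicate n b := by
    refine (Primrec.list_map Primrec.list_range (Primrec.const b).to₂).of_eq fun n => ?_
    simp [List.map_const']
  exact (Primrec.list_append.comp (Primrec.const x)
    (Primrec.list_append.comp h (Primrec.const y))).to_comp

/-- The common term problem is undecidable already for a fixed system and a fixed left string. -/
theorem exists_undecidable_system : ∃ (k : ℕ) (S : FiniteSRS (Fin k)) (α x y : List (Fin k))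
    (b : Fin k), Dwindling S ∧ Convergent S ∧
      ¬ ComputablePred fun n : ℕ => HasCommonTerm S α (x ++ (List.replicate n b ++ y)) := by
  obtain ⟨Γ, Λ, _, _, _, M, T, hT, hM, x, y, b, h⟩ := exists_undecidable_machine
  have : Finite T := hT
  let _ : Fintype (SimIndex Γ Λ T) := Fintype.ofFinite _
  let L := Letter (Option Γ) (Option T) (SimIndex Γ Λ T)
  obtain ⟨k, ⟨e⟩⟩ := Finite.exists_equiv_fin L
  let S : FiniteSRS L := machineRules (simInstr M T) none none
  -- `leftWord` ignores the right stack, so `[]` can stand for it and the left string does not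
  -- depend on `n`.
  refine ⟨k, S.rename e, (leftWord _ (stackOf [x], simState T default, [])).map e,
    [e (.sym none)], [e (.sym (some y))], e (.sym (some b)),
    machineRules_opTerminated.dwindling.rename e, machineRules_opTerminated.convergent.rename e,
    fun hc => h (hc.of_eq fun n => ?_)⟩
  -- Tops of stacks are at the ends of lists, so the cells right of the head appear in reverse
  -- order, with `y` last.
  have hβ : [e (.sym none)] ++ (List.replicate n (e (.sym (some b))) ++ [e (.sym (some y))]) =
      (rightWord (SimIndex Γ Λ T) (stackOf [x], simState T default,
        stackOf (List.replicate n b ++ [y]))).map e := by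
    simp [rightWord, stackOf]
  have htape : (TM0.init (x :: y :: List.replicate n b) : TM0.Cfg Γ Λ) =
      ⟨default, tapeOf [x] (List.replicate n b ++ [y])⟩ := by
    simp [TM0.init, Tape.mk₁, Tape.mk₂, tapeOf]
  rw [hβ, htape, hasCommonTerm_rename_iff]
  exact hasCommonTerm_simInstr_iff hM hM.1 _ _

end Undecidability

end StringRewriting

theorem mainTheorem2 :
    ¬ ∃ decider : StringRewriting.CTInput →. Bool, Partrec decider ∧
      ∀ (k : ℕ) (S : StringRewriting.FiniteSRS (Fin k)) (α β : List (Fin k)),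
        0 < k → StringRewriting.Dwindling S → StringRewriting.Convergent S →
          ∃ answer : Bool, answer ∈ decider (StringRewriting.encodeInstance S α β) ∧
            (answer = true ↔ StringRewriting.HasCommonTerm S α β) := by
  rintro ⟨decider, hd, h⟩
  obtain ⟨k, S, α, x, y, b, hS, hC, hu⟩ := StringRewriting.exists_undecidable_system
  -- The letter `b` witnesses that the alphabet is nonempty. Only the right string varies with `n`.
  refine hu (StringRewriting.computablePred_of_decider hd ?_ fun n =>
    h k S α (x ++ (List.replicate n b ++ y)) b.pos hS hC)
  simp only [StringRewriting.encodeInstance, StringRewriting.encodeString_eq_map, List.map_append,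
    List.map_replicate]
  exact (Computable.const _).pair ((Computable.const _).pair ((Computable.const _).pair
    (StringRewriting.computable_append_replicate _ _ _)))
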